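/- Let $d\ge 1$ and equip $\{0,1\}^d$ with the coordinatewise order and the uniform distribution $\mu$. Write $\|g\|_2^2=2^{-d}\sum_{x}g(x)^2$, and for $f:\{0,1\}^d\to\mathbb R$ let $I(f)=\sum_{i=1}^d \mathbb E_\mu\big|f(X^{i\to1})-f(X^{i\to0})\big|$ be the total $L^1$-influence, where $x^{i\to b}$ is $x$ with its $i$-th coordinate replaced by $b$. For $K>0$ let $\mathcal F_K$ be the class of coordinatewise nondecreasing $f:\{0,1\}^d\to[0,1]$ with $I(f)\le K$. Fix $\sigma\ge 0$. The sample is $\mathcal D_n=\{(X_j,Y_j)\}_{j=1}^n$ with $Y_j=f(X_j)+\varepsilon_j$, where $X_1,\dots,X_n$ are i.i.d. with law $\mu$ and the noise variables $\varepsilon_1,\dots,\varepsilon_n$ are independent, independent of the $X_j$, centered, and satisfy $\mathbb E[e^{t\varepsilon_j}]\le e^{\sigma^2t^2/2}$ for all $t\in\mathbb R$ (such noise is called admissible; the $\varepsilon_j$ need not have the same law). The risk of an estimator $\tilde f=\tilde f(\mathcal D_n)$ is $R(\tilde f,f)=\mathbb E\,\|\tilde f-f\|_2^2$. For constants $\gamma>2\log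 3$ and $c_0>0$, the Fourier thresholding estimator $\hat f_n$ is defined as follows. Put $n_1=\lfloor n/2\rfloor$, $n_2=n-n_1$, $$d_0=\max\Big(\Big\lceil\sqrt{(\log n-c_0\sqrt{\log n})_+/\gamma}\,\Big\rceil,1\Big),\qquad \delta=e^{-\gamma d_0}.$$ For $i\in\{1,\dots,d\}$ and $b\in\{0,1\}$ let $\bar Y_{i,b}$ be the mean of those $Y_j$ with $j\le n_1$ and $X_{j,i}=b$ (and $0$ if there are none), and let $\hat J=\{i:\bar Y_{i,1}-\bar Y_{i,0}\ge\delta/2\}$. With $\chi_S(x)=\prod_{i\in S}(2x_i-1)$ and $\tilde f(S)=\frac1{n_2}\sum_{j=n_1+1}^{n}Y_j\chi_S(X_j)$, put $$\hat f_n(x)=\max\Big(0,\min\Big(\sum_{S\subseteq\hat J,\ |S|\le d_0}\tilde f(S)\chi_S(x),\,1\Big)\Big).$$ **Theorem (minimax bounds).** There are universal constants $\gamma>2\log3$ and $c_0>0$ such that for every $\varepsilon\in(0,1)$ and every $\sigma\ge0$ there are constants $c,C>0$, depending only on $\sigma$ and $\varepsilon$, such that the following holds for all integers $n\ge2$ and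 $d\ge1$ and for every admissible noise. (i) If $\log d\le n^{1-\varepsilon}$, then the estimator $\hat f_n$ with constants $\gamma,c_0$ (which does not depend on $K$) satisfies, for every real $K$ with $1\le K\le d$, $$\sup_{f\in\mathcal F_K}R(\hat f_n,f)\le C\,\frac{K}{\sqrt{\log n}}.$$ (ii) If $d\ge(1/c)\log n$, then for every real $K$ with $0<K\le c\sqrt{\log n}$, $$\inf_{\tilde f}\ \sup_{f\in\mathcal F_K}R(\tilde f,f)\ge c\,\frac{K^2}{(\log n)^{3/2}},$$ where the infimum is over all (measurable) estimators $\tilde f=\tilde f(\mathcal D_n)$. -/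

import Mathlib

open scoped NNReal ENNReal

namespace MonotoneCube

noncomputable section

/-- The Boolean hypercube `{0,1}^d` (`false = 0`, `true = 1`), with the coordinatewise order. -/
abbrev Cube (d : ℕ) : Type := Fin d → Bool

/-- The uniform distribution on the hypercube. -/
def unif (d : ℕ) : MeasureTheory.Measure (Cube d) :=
  ProbabilityTheory.uniformOn (Set.univ : Set (Cube d))

/-- Expectation under the uniform distribution: `2^{-d} ∑ₓ g x`. -/
def mean {d : ℕ} (g : Cube d → ℝ) : ℝ :=
  (∑ x : Cube d, g x) / 2 ^ d

/-- The squared norm `‖g‖₂² = 2^{-d} ∑ₓ g(x)²`. -/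
def normSq {d : ℕ} (g : Cube d → ℝ) : ℝ :=
  mean fun x => g x ^ 2

/-- The discrete derivative `Δᵢ f(x) = f(x^{i→1}) - f(x^{i→0})`. -/
def discreteDeriv {d : ℕ} (i : Fin d) (f : Cube d → ℝ) (x : Cube d) : ℝ :=
  f (Function.update x i true) - f (Function.update x i false)

/-- The `L¹`-influence of coordinate `i`. -/
def influence {d : ℕ} (i : Fin d) (f : Cube d → ℝ) : ℝ :=
  mean fun x => |discreteDeriv i f x|

/-- The total `L¹`-influence `I(f)`. -/
def totalInfluence {d : ℕ} (f : Cube d → ℝ) : ℝ :=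
  ∑ i : Fin d, influence i f

/-- The class `F_K` of monotone functions `{0,1}^d → [0,1]` with total influence at most `K`. -/
def monotoneClass (d : ℕ) (K : ℝ) : Set (Cube d → ℝ) :=
  {f | (∀ x, f x ∈ Set.Icc (0 : ℝ) 1) ∧ Monotone f ∧ totalInfluence f ≤ K}

/-- A sample `((X₁, Y₁), …, (Xₙ, Yₙ))`. -/
abbrev Sample (n d : ℕ) : Type := Fin n → Cube d × ℝ

/-- The laws `ν j` of the noise variables: probability measures on the line that are centered and
satisfy `E[exp (t ε)] ≤ exp (σ² t² / 2)` for all real `t`. They need not be identical. -/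
structure IsNoise {n : ℕ} (σ : ℝ≥0) (ν : Fin n → MeasureTheory.Measure ℝ) : Prop where
  isProbabilityMeasure : ∀ j, MeasureTheory.IsProbabilityMeasure (ν j)
  centered : ∀ j, ∫ e, e ∂(ν j) = 0
  subgaussian : ∀ j, ProbabilityTheory.HasSubgaussianMGF (fun e : ℝ => e) (σ ^ 2) (ν j)

/-- The law of the sample: the pairs `(Xⱼ, f(Xⱼ) + εⱼ)` are independent, `Xⱼ` is uniform on the
hypercube, `εⱼ` has law `ν j`, and `εⱼ` is independent of `Xⱼ`. -/
def sampleLaw {n d : ℕ} (ν : Fin n → MeasureTheory.Measure ℝ) (f : Cube d → ℝ) :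
    MeasureTheory.Measure (Sample n d) :=
  MeasureTheory.Measure.pi fun j =>
    ((unif d).prod (ν j)).map fun p : Cube d × ℝ => (p.1, f p.1 + p.2)

/-- The integrated squared risk `R(g, f) = E[‖g(D) - f‖₂²]` of the estimator `g`, as an extended
nonnegative real number. -/
def risk {n d : ℕ} (ν : Fin n → MeasureTheory.Measure ℝ) (g : Sample n d → Cube d → ℝ)
    (f : Cube d → ℝ) : ℝ≥0∞ :=
  ∫⁻ D, ENNReal.ofReal (normSq fun x => g D x - f x) ∂(sampleLaw ν f)

/-- The worst-case risk of the estimator `g` over `F_K`. -/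
def worstRisk {n d : ℕ} (ν : Fin n → MeasureTheory.Measure ℝ) (K : ℝ)
    (g : Sample n d → Cube d → ℝ) : ℝ≥0∞ :=
  ⨆ f ∈ monotoneClass d K, risk ν g f

/-- The minimax risk over `F_K`: the infimum is over all (measurable, real-valued) estimators. -/
def minimaxRisk {n d : ℕ} (ν : Fin n → MeasureTheory.Measure ℝ) (K : ℝ) : ℝ≥0∞ :=
  ⨅ (g : Sample n d → Cube d → ℝ) (_ : Measurable g), worstRisk ν K g

/-- The character `χ_S(x) = ∏_{i ∈ S} (2 xᵢ - 1)`. -/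
def character {d : ℕ} (S : Finset (Fin d)) (x : Cube d) : ℝ :=
  ∏ i ∈ S, if x i then (1 : ℝ) else -1

/-- The degree cut-off `d₀` of the Fourier thresholding estimator. -/
def cutoff (γ c₀ : ℝ) (n : ℕ) : ℕ :=
  max ⌈√(max (Real.log n - c₀ * √(Real.log n)) 0 / γ)⌉₊ 1

/-- The influence threshold `δ = exp (-γ d₀)`. -/
def threshold (γ c₀ : ℝ) (n : ℕ) : ℝ :=
  Real.exp (-(γ * cutoff γ c₀ n))

/-- The first `⌊n/2⌋` indices, used for the selection of variables. -/
def firstHalf (n : ℕ) : Finset (Fin n) :=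
  Finset.univ.filter fun j => (j : ℕ) < n / 2

/-- The remaining `n - ⌊n/2⌋` indices, used for the Fourier coefficients. -/
def secondHalf (n : ℕ) : Finset (Fin n) :=
  Finset.univ.filter fun j => n / 2 ≤ (j : ℕ)

/-- The mean of the responses over those observations in the first half whose `i`-th coordinate
is `b` (equal to `0` if there are none). -/
def condMean {n d : ℕ} (D : Sample n d) (i : Fin d) (b : Bool) : ℝ :=
  (∑ j ∈ (firstHalf n).filter (fun j => (D j).1 i = b), (D j).2) /
    (((firstHalf n).filter (fun j => (D j).1 i = b)).card : ℝ)

/-- The empirical influence of coordinate `i`. -/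
def empInfluence {n d : ℕ} (D : Sample n d) (i : Fin d) : ℝ :=
  condMean D i true - condMean D i false

/-- The set of selected coordinates: those with empirical influence at least `δ/2`. -/
def selected {n d : ℕ} (γ c₀ : ℝ) (D : Sample n d) : Finset (Fin d) :=
  Finset.univ.filter fun i => threshold γ c₀ n / 2 ≤ empInfluence D i

/-- The empirical Fourier coefficient at `S`, from the second half of the sample. -/
def empCoeff {n d : ℕ} (D : Sample n d) (S : Finset (Fin d)) : ℝ :=
  (∑ j ∈ secondHalf n, (D j).2 * character S (D j).1) / ((secondHalf n).card : ℝ)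

/-- The Fourier thresholding estimator: the Fourier series with empirical coefficients over the
sets of at most `d₀` selected coordinates, truncated to `[0,1]`. -/
def fourierEstimator {n d : ℕ} (γ c₀ : ℝ) (D : Sample n d) (x : Cube d) : ℝ :=
  max 0 (min (∑ S ∈ (selected γ c₀ D).powerset.filter (fun S => S.card ≤ cutoff γ c₀ n),
    empCoeff D S * character S x) 1)

end

end MonotoneCube

/-! Upper bound. Take `γ = 4`, `c₀ = 9`, and write `k` for the degree cut-off, of order `√(log n)`,
and `δ = exp (-4k)`. By Parseval the squared error splits into the errors of the empirical
coefficients and the Fourier weight of `f` outside the family used. That weight has two sources.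
Degrees above `k` carry at most `I(f) / (4k)`, because `∑ |S| f̂(S)² ≤ I(f) / 4`. Sets of size at
most `k` containing a coordinate of influence at most `δ` are handled by the level inequality (from
Bonami's `L²`-`L⁴` bound) applied to each discrete derivative: their total weight is at most `3^k √δ
I(f) / 4`, exponentially small in `k` because `γ > 2 log 3`. Monotonicity makes the influence a
difference of two conditional means, so subgaussian concentration selects the right coordinates
simultaneously. Since `δ = exp (-O(√(log n)))`, the exponent `n δ²` dominates any `log d ≤ n^(1-ε)`.
At most `4K / δ` coordinates have influence at least `δ / 4`, hence at most `e^(4K) δ^(-k)`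
coefficients are estimated, each with mean squared error `O(1/n)`; the cut-off keeps this total of
order `1 / √(log n)` for `K ≤ √(log n)`. For larger `K` the trivial bound `1` on the risk suffices.
The main steps are `sum_notMem_lowSubsets_le`, `risk_fourierEstimator_le` and
`exists_worstRisk_fourierEstimator_le`.

Lower bound. Use `2k` coordinates, with a new `k` of order `log n`, and functions equal to `a` above
the middle layer, `0` below it, and arbitrary in `{0, a}` on it. They are monotone with influence at
most `2a√(2k)`, so `a` may be of order `K / √k`. The layer has mass of order `1 / √k`, and `n`
design points miss a fixed fraction of it. At a missed point the data carry no information, so the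
averaged squared error there is at least `a² / 4`, which gives `K² / k^(3/2)` up to a constant. This
is `minimaxRisk_ge`, with parameters chosen in `minimaxRisk_ge_rate`. -/

namespace MonotoneCube

noncomputable section

/-! ### Averages over the cube and coordinate flips. -/

section Mean

variable {d : ℕ}

theorem mean_add (f g : Cube d → ℝ) : mean (fun x => f x + g x) = mean f + mean g := by
  simp [mean, Finset.sum_add_distrib, add_div]

theorem mean_sub (f g : Cube d → ℝ) : mean (fun x => f x - g x) = mean f - mean g := by
  simp [mean, Finset.sum_sub_distrib, sub_div]

theorem mean_const_mul (c : ℝ) (f : Cube d → ℝ) : mean (fun x => c * f x) = c * mean f := by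
  simp [mean, ← Finset.mul_sum, mul_div_assoc]

theorem mean_const (c : ℝ) : mean (fun _ : Cube d => c) = c := by
  simp [mean]

theorem mean_sum {ι : Type*} (s : Finset ι) (f : ι → Cube d → ℝ) :
    mean (fun x => ∑ i ∈ s, f i x) = ∑ i ∈ s, mean (f i) := by
  simp only [mean, Finset.sum_div]
  rw [Finset.sum_comm]

theorem mean_mono {f g : Cube d → ℝ} (h : ∀ x, f x ≤ g x) : mean f ≤ mean g := by
  unfold mean
  gcongr with x
  exact h x

theorem mean_nonneg {f : Cube d → ℝ} (h : ∀ x, 0 ≤ f x) : 0 ≤ mean f :=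
  div_nonneg (Finset.sum_nonneg fun x _ => h x) (by positivity)

theorem mean_mul_sq_le (f g : Cube d → ℝ) :
    mean (fun x => f x * g x) ^ 2 ≤ mean (fun x => f x ^ 2) * mean (fun x => g x ^ 2) := by
  simp only [mean]
  rw [div_pow, div_mul_div_comm, ← sq]
  gcongr
  exact Finset.sum_mul_sq_le_sq_mul_sq _ _ _

/-- The point `x` with its `i`-th coordinate flipped. -/
def flip (i : Fin d) (x : Cube d) : Cube d := Function.update x i (!x i)

theorem flip_flip (i : Fin d) (x : Cube d) : flip i (flip i x) = x := by
  simp [flip]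

theorem mean_flip (i : Fin d) (f : Cube d → ℝ) : mean (fun x => f (flip i x)) = mean f := by
  unfold mean
  congr 1
  exact Equiv.sum_comp ⟨flip i, flip i, flip_flip i, flip_flip i⟩ f

theorem mean_eq_half_flip (i : Fin d) (f : Cube d → ℝ) :
    mean f = mean (fun x => f x + f (flip i x)) / 2 := by
  rw [mean_add, mean_flip]; ring

end Mean

/-! ### Fourier analysis on the cube: Parseval, Bonami and the level inequality. -/

section Fourier

variable {d : ℕ}

/-- The `i`-th coordinate with values in `{-1, 1}`. -/
def spin (i : Fin d) (x : Cube d) : ℝ := if x i then 1 else -1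

theorem character_eq (S : Finset (Fin d)) (x : Cube d) : character S x = ∏ i ∈ S, spin i x := rfl

theorem spin_sq (i : Fin d) (x : Cube d) : spin i x ^ 2 = 1 := by
  unfold spin; split <;> norm_num

theorem spin_flip_self (i : Fin d) (x : Cube d) : spin i (flip i x) = -spin i x := by
  unfold spin flip; cases h : x i <;> simp

theorem spin_flip_of_ne {i j : Fin d} (h : j ≠ i) (x : Cube d) : spin j (flip i x) = spin j x := by
  unfold spin flip; simp [h]

theorem character_sq (S : Finset (Fin d)) (x : Cube d) : character S x ^ 2 = 1 := by
  rw [character_eq, ← Finset.prod_pow]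
  exact Finset.prod_eq_one fun i _ => spin_sq i x

theorem abs_character (S : Finset (Fin d)) (x : Cube d) : |character S x| = 1 := by
  rw [← abs_one, ← sq_eq_sq_iff_abs_eq_abs, character_sq, one_pow]

theorem character_flip_of_notMem {i : Fin d} {S : Finset (Fin d)} (h : i ∉ S) (x : Cube d) :
    character S (flip i x) = character S x := by
  simp only [character_eq]
  exact Finset.prod_congr rfl fun j hj => spin_flip_of_ne (ne_of_mem_of_not_mem hj h) x

theorem character_flip_of_mem {i : Fin d} {S : Finset (Fin d)} (h : i ∈ S) (x : Cube d) :
    character S (flip i x) = -character S x := by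
  simp only [character_eq]
  rw [← Finset.mul_prod_erase S _ h, ← Finset.mul_prod_erase S (fun j => spin j x) h,
    spin_flip_self, neg_mul]
  congr 2
  exact Finset.prod_congr rfl fun j hj => spin_flip_of_ne (Finset.ne_of_mem_erase hj) x

theorem character_insert {i : Fin d} {S : Finset (Fin d)} (h : i ∉ S) (x : Cube d) :
    character (insert i S) x = spin i x * character S x := by
  simp only [character_eq]
  exact Finset.prod_insert h

theorem mean_character_mul (S T : Finset (Fin d)) :
    mean (fun x => character S x * character T x) = if S = T then 1 else 0 := by
  split_ifs with h
  · subst h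
    simp only [← sq, character_sq, mean_const]
  · obtain ⟨i, hi⟩ : ∃ i, ¬(i ∈ S ↔ i ∈ T) := by
      by_contra! h'
      exact h (Finset.ext h')
    rw [mean_eq_half_flip i]
    have : ∀ x : Cube d, character S x * character T x
        + character S (flip i x) * character T (flip i x) = 0 := by
      intro x
      by_cases hS : i ∈ S <;> by_cases hT : i ∈ T
      · simp [hS, hT] at hi
      · rw [character_flip_of_mem hS, character_flip_of_notMem hT]; ring
      · rw [character_flip_of_notMem hS, character_flip_of_mem hT]; ring
      · simp [hS, hT] at hi
    simp only [this, mean_const, zero_div]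

/-- The Fourier coefficient of `f` at `S`. -/
def fourierCoeff (f : Cube d → ℝ) (S : Finset (Fin d)) : ℝ := mean fun x => f x * character S x

theorem sum_character_mul (x y : Cube d) :
    ∑ S : Finset (Fin d), character S x * character S y = if x = y then 2 ^ d else 0 := by
  have : ∑ S : Finset (Fin d), character S x * character S y
      = ∏ i : Fin d, (1 + spin i x * spin i y) := by
    rw [Finset.prod_one_add, Finset.powerset_univ]
    simp only [character_eq, Finset.prod_mul_distrib]
  rw [this]
  split_ifs with h
  · subst h
    simp only [← sq, spin_sq]
    norm_num
  · obtain ⟨i, hi⟩ := Function.ne_iff.1 h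
    refine Finset.prod_eq_zero (Finset.mem_univ i) ?_
    unfold spin
    cases hx : x i <;> cases hy : y i <;> simp_all

theorem fourier_inversion (f : Cube d → ℝ) (x : Cube d) :
    ∑ S : Finset (Fin d), fourierCoeff f S * character S x = f x := by
  have : ∀ S : Finset (Fin d), fourierCoeff f S * character S x
      = (∑ y, f y * (character S x * character S y)) / 2 ^ d := by
    intro S
    simp only [fourierCoeff, mean, div_mul_eq_mul_div, Finset.sum_mul]
    congr 1
    exact Finset.sum_congr rfl fun y _ => by ring
  simp only [this, ← Finset.sum_div]
  rw [Finset.sum_comm]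
  simp only [← Finset.mul_sum, sum_character_mul]
  simp

theorem normSq_fourierSeries (a : Finset (Fin d) → ℝ) :
    normSq (fun x => ∑ S, a S * character S x) = ∑ S, a S ^ 2 := by
  have : ∀ x : Cube d, (∑ S, a S * character S x) ^ 2
      = ∑ S, ∑ T, (a S * a T) * (character S x * character T x) := by
    intro x
    rw [sq, Finset.sum_mul_sum]
    exact Finset.sum_congr rfl fun S _ => Finset.sum_congr rfl fun T _ => by ring
  simp only [normSq, this, mean_sum, mean_const_mul, mean_character_mul]
  simp [sq]

theorem parseval (f : Cube d → ℝ) : normSq f = ∑ S, fourierCoeff f S ^ 2 := by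
  rw [← normSq_fourierSeries]
  simp only [fourier_inversion]

/-- The **Bonami inequality**: the operator with multiplier `3^{-|S|/2}` maps `L²` contractively
into `L⁴`. -/
theorem mean_pow_four_le (V : Finset (Fin d)) (a : Finset (Fin d) → ℝ) :
    mean (fun x => (∑ S ∈ V.powerset, a S * character S x) ^ 4) ≤
      (∑ S ∈ V.powerset, 3 ^ S.card * a S ^ 2) ^ 2 := by
  induction V using Finset.induction_on generalizing a with
  | empty =>
    simp only [Finset.powerset_empty, Finset.sum_singleton, Finset.card_empty, pow_zero, one_mul]
    have : ∀ x : Cube d, (a ∅ * character ∅ x) ^ 4 = a ∅ ^ 4 := by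
      intro x; simp [character]
    simp only [this, mean_const]
    exact le_of_eq (by ring)
  | insert i V hi ih =>
    set q : Cube d → ℝ := fun x => ∑ S ∈ V.powerset, a S * character S x with hq
    set r : Cube d → ℝ := fun x => ∑ S ∈ V.powerset, a (insert i S) * character S x with hr
    set A := ∑ S ∈ V.powerset, 3 ^ S.card * a S ^ 2 with hA
    set B := ∑ S ∈ V.powerset, 3 ^ S.card * a (insert i S) ^ 2 with hB
    have hA0 : 0 ≤ A := Finset.sum_nonneg fun S _ => by positivity
    have hB0 : 0 ≤ B := Finset.sum_nonneg fun S _ => by positivity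
    have hmem : ∀ S ∈ V.powerset, i ∉ S := fun S hS h => hi (Finset.mem_powerset.1 hS h)
    have hp : ∀ x, ∑ S ∈ (insert i V).powerset, a S * character S x = q x + spin i x * r x := by
      intro x
      rw [Finset.sum_powerset_insert hi, hq, hr, Finset.mul_sum]
      congr 1
      refine Finset.sum_congr rfl fun S hS => ?_
      rw [character_insert (hmem S hS)]; ring
    have hc : ∑ S ∈ (insert i V).powerset, 3 ^ S.card * a S ^ 2 = A + 3 * B := by
      rw [Finset.sum_powerset_insert hi, hB, Finset.mul_sum]
      congr 1
      refine Finset.sum_congr rfl fun S hS => ?_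
      rw [Finset.card_insert_of_notMem (hmem S hS)]; ring
    have hqf : ∀ x, q (flip i x) = q x := fun x =>
      Finset.sum_congr rfl fun S hS => by rw [character_flip_of_notMem (hmem S hS)]
    have hrf : ∀ x, r (flip i x) = r x := fun x =>
      Finset.sum_congr rfl fun S hS => by rw [character_flip_of_notMem (hmem S hS)]
    -- Neither `q` nor `r` depends on coordinate `i`, so averaging over its flip kills the odd
    -- powers of `spin i`. With Cauchy–Schwarz for the mixed term, the induction closes by `A² + 6AB
    -- + B² ≤ (A + 3B)²`.
    have key : mean (fun x => (q x + spin i x * r x) ^ 4)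
        = mean (fun x => q x ^ 4) + 6 * mean (fun x => q x ^ 2 * r x ^ 2)
          + mean (fun x => r x ^ 4) := by
      rw [mean_eq_half_flip i, ← mean_const_mul, ← mean_add, ← mean_add, div_eq_inv_mul,
        ← mean_const_mul]
      congr 1
      ext x
      rw [hqf, hrf, spin_flip_self]
      have h2 := spin_sq i x
      have h4 : spin i x ^ 4 = 1 := by rw [show (4 : ℕ) = 2 * 2 from rfl, pow_mul, h2, one_pow]
      linear_combination (6 * q x ^ 2 * r x ^ 2) * h2 + r x ^ 4 * h4
    have h1 : mean (fun x => q x ^ 4) ≤ A ^ 2 := ih a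
    have h2 : mean (fun x => r x ^ 4) ≤ B ^ 2 := ih fun S => a (insert i S)
    have h3 : mean (fun x => q x ^ 2 * r x ^ 2) ≤ A * B := by
      refine (abs_le_of_sq_le_sq' ?_ (mul_nonneg hA0 hB0)).2
      refine (mean_mul_sq_le _ _).trans ?_
      simp only [← pow_mul, mul_pow]
      exact mul_le_mul h1 h2 (mean_nonneg fun x => by rw [pow_mul]; positivity) (sq_nonneg A)
    simp only [hp, hc, key]
    nlinarith [sq_nonneg B]

theorem mean_pow_four_le_of_card_le (k : ℕ) (a : Finset (Fin d) → ℝ)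
    (ha : ∀ S, k < S.card → a S = 0) :
    mean (fun x => (∑ S, a S * character S x) ^ 4) ≤ (3 ^ k * ∑ S, a S ^ 2) ^ 2 := by
  have h := mean_pow_four_le Finset.univ a
  rw [Finset.powerset_univ] at h
  refine h.trans (pow_le_pow_left₀ (Finset.sum_nonneg fun S _ => by positivity) ?_ 2)
  rw [Finset.mul_sum]
  refine Finset.sum_le_sum fun S _ => ?_
  by_cases hS : k < S.card
  · simp [ha S hS]
  · gcongr
    · norm_num
    · omega

/-- The **level inequality**: a function bounded by one with small mean absolute value has little
Fourier weight on low degrees. -/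
theorem sum_fourierCoeff_sq_le (k : ℕ) (g : Cube d → ℝ) (hg : ∀ x, |g x| ≤ 1) :
    ∑ S with S.card ≤ k, fourierCoeff g S ^ 2 ≤
      3 ^ k * mean (fun x => |g x|) * √(mean (fun x => |g x|)) := by
  set I := mean (fun x => |g x|) with hI
  have hI0 : 0 ≤ I := mean_nonneg fun x => abs_nonneg _
  set a : Finset (Fin d) → ℝ := fun S => if S.card ≤ k then fourierCoeff g S else 0 with ha
  set W := ∑ S, a S ^ 2 with hW
  have hW0 : 0 ≤ W := Finset.sum_nonneg fun S _ => sq_nonneg _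
  have hWeq : ∑ S with S.card ≤ k, fourierCoeff g S ^ 2 = W := by
    rw [hW, Finset.sum_filter]
    refine Finset.sum_congr rfl fun S _ => ?_
    simp only [ha]
    split_ifs <;> simp
  set p : Cube d → ℝ := fun x => ∑ S, a S * character S x with hp
  have h4 : mean (fun x => p x ^ 4) ≤ (3 ^ k * W) ^ 2 :=
    mean_pow_four_le_of_card_le k a fun S hS => by simp [ha, Nat.not_le.2 hS]
  -- By orthogonality `W` is the mean of `g * p`. The product is split so that Cauchy–Schwarz yields
  -- `p² |g|` and `|g|`; a second application then brings in the fourth moment of `p`, giving `W⁴ ≤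
  -- 9^k W² I³`.
  have hWp : W = mean (fun x => (|p x| * √|g x|) * (√|g x| * (SignType.sign (p x) *
      SignType.sign (g x) : ℝ))) := by
    have h1 : ∀ x, (|p x| * √|g x|) * (√|g x| * (SignType.sign (p x) *
        SignType.sign (g x) : ℝ)) = ∑ S, a S * (g x * character S x) := by
      intro x
      calc _ = (√|g x| * √|g x| * SignType.sign (g x)) * (|p x| * SignType.sign (p x)) := by ring
        _ = g x * p x := by
          rw [Real.mul_self_sqrt (abs_nonneg _), abs_mul_sign, abs_mul_sign]
        _ = _ := by
          rw [hp, Finset.mul_sum]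
          exact Finset.sum_congr rfl fun S _ => by ring
    simp only [h1, mean_sum, mean_const_mul]
    refine Finset.sum_congr rfl fun S _ => ?_
    simp only [ha, fourierCoeff]
    split_ifs <;> ring
  have hs : ∀ y : ℝ, (SignType.sign y : ℝ) ^ 2 ≤ 1 := by
    intro y
    rcases lt_trichotomy y 0 with h | h | h <;> simp [h]
  have h5 : W ^ 2 ≤ mean (fun x => p x ^ 2 * |g x|) * I := by
    conv_lhs => rw [hWp]
    refine (mean_mul_sq_le _ _).trans ?_
    refine mul_le_mul (mean_mono fun x => ?_) (mean_mono fun x => ?_)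
      (mean_nonneg fun x => sq_nonneg _) (mean_nonneg fun x => by positivity)
    · rw [mul_pow, sq_abs, Real.sq_sqrt (abs_nonneg _)]
    · rw [mul_pow, mul_pow, Real.sq_sqrt (abs_nonneg _)]
      exact mul_le_of_le_one_right (abs_nonneg _)
        (mul_le_one₀ (hs _) (sq_nonneg _) (hs _))
  have h6 : mean (fun x => p x ^ 2 * |g x|) ^ 2 ≤ (3 ^ k * W) ^ 2 * I := by
    refine (mean_mul_sq_le _ _).trans ?_
    refine mul_le_mul ?_ (mean_mono fun x => ?_) (mean_nonneg fun x => sq_nonneg _) (by positivity)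
    · simpa only [← pow_mul] using h4
    · rw [sq]
      exact mul_le_of_le_one_left (abs_nonneg _) (hg x)
  rw [hWeq]
  have h7 : W ^ 4 ≤ (3 ^ k * W) ^ 2 * I * I ^ 2 := by
    calc W ^ 4 = (W ^ 2) ^ 2 := by ring
      _ ≤ (mean (fun x => p x ^ 2 * |g x|) * I) ^ 2 := by gcongr
      _ = mean (fun x => p x ^ 2 * |g x|) ^ 2 * I ^ 2 := by ring
      _ ≤ _ := by gcongr
  rcases hW0.eq_or_lt with h0 | h0
  · rw [← h0]; positivity
  · refine abs_le_of_sq_le_sq' ?_ (by positivity) |>.2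
    have h8 : W ^ 2 * W ^ 2 ≤ W ^ 2 * ((3 ^ k * I * √I) ^ 2) := by
      rw [mul_pow, Real.sq_sqrt hI0]
      linarith
    exact le_of_mul_le_mul_left h8 (by positivity)

end Fourier

/-! ### Truncation bias and the number of retained coefficients. -/

section Bias

variable {d : ℕ}

theorem update_eq_ite_flip (i : Fin d) (b : Bool) (x : Cube d) :
    Function.update x i b = if x i = b then x else flip i x := by
  split_ifs with h
  · rw [← h, Function.update_eq_self]
  · rw [flip]
    congr 1
    cases hx : x i <;> cases b <;> simp_all

theorem abs_sub_flip (i : Fin d) (f : Cube d → ℝ) (x : Cube d) :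
    |f x - f (flip i x)| = |discreteDeriv i f x| := by
  rw [discreteDeriv, update_eq_ite_flip, update_eq_ite_flip]
  cases h : x i
  · simp [abs_sub_comm]
  · simp

theorem influence_eq (i : Fin d) (f : Cube d → ℝ) :
    influence i f = mean fun x => |f x - f (flip i x)| := by
  simp only [influence, abs_sub_flip]

theorem influence_nonneg (i : Fin d) (f : Cube d → ℝ) : 0 ≤ influence i f :=
  mean_nonneg fun _ => abs_nonneg _

theorem fourierCoeff_sub_flip (f : Cube d → ℝ) {i : Fin d} {S : Finset (Fin d)} (h : i ∈ S) :
    fourierCoeff (fun x => f x - f (flip i x)) S = 2 * fourierCoeff f S := by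
  unfold fourierCoeff
  rw [mean_eq_half_flip i (fun x => f x * character S x), mul_div_cancel₀ _ two_ne_zero]
  congr 1
  ext x
  rw [character_flip_of_mem h]
  ring

theorem abs_sub_flip_le_one {f : Cube d → ℝ} (hf : ∀ x, f x ∈ Set.Icc (0 : ℝ) 1) (i : Fin d)
    (x : Cube d) : |f x - f (flip i x)| ≤ 1 := by
  have h1 := hf x
  have h2 := hf (flip i x)
  rw [Set.mem_Icc] at h1 h2
  rw [abs_le]
  constructor <;> linarith

/-- Parseval for each discrete derivative gives the `L²`-influence; the derivative is bounded by
one, so its square is at most its absolute value and the `L¹`-influence suffices. -/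
theorem sum_sum_mem_fourierCoeff_le {f : Cube d → ℝ} (hf : ∀ x, f x ∈ Set.Icc (0 : ℝ) 1) :
    ∑ S : Finset (Fin d), S.card * fourierCoeff f S ^ 2 ≤ totalInfluence f / 4 := by
  have h1 : ∀ S : Finset (Fin d), S.card * fourierCoeff f S ^ 2
      = ∑ i : Fin d, if i ∈ S then fourierCoeff f S ^ 2 else 0 := by
    intro S
    rw [← Finset.sum_filter, Finset.sum_const, nsmul_eq_mul]
    simp
  simp only [h1]
  rw [Finset.sum_comm, totalInfluence, Finset.sum_div]
  refine Finset.sum_le_sum fun i _ => ?_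
  set g : Cube d → ℝ := fun x => f x - f (flip i x) with hg
  calc ∑ S : Finset (Fin d), (if i ∈ S then fourierCoeff f S ^ 2 else 0)
      ≤ ∑ S : Finset (Fin d), fourierCoeff g S ^ 2 / 4 := by
        refine Finset.sum_le_sum fun S _ => ?_
        split_ifs with h
        · rw [hg, fourierCoeff_sub_flip f h]
          exact le_of_eq (by ring)
        · positivity
    _ = normSq g / 4 := by rw [parseval, Finset.sum_div]
    _ ≤ influence i f / 4 := by
        rw [influence_eq]
        refine div_le_div_of_nonneg_right (mean_mono fun x => ?_) (by norm_num)
        rw [← sq_abs, sq]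
        exact mul_le_of_le_one_left (abs_nonneg _) (abs_sub_flip_le_one hf i x)

theorem sum_card_gt_fourierCoeff_le {f : Cube d → ℝ} (hf : ∀ x, f x ∈ Set.Icc (0 : ℝ) 1) {k : ℕ}
    (hk : 0 < k) :
    ∑ S : Finset (Fin d) with k < S.card, fourierCoeff f S ^ 2 ≤ totalInfluence f / (4 * k) := by
  have hk' : (0 : ℝ) < k := by exact_mod_cast hk
  rw [← div_div, le_div_iff₀ hk', Finset.sum_mul]
  refine le_trans ?_ (sum_sum_mem_fourierCoeff_le hf)
  refine le_trans (Finset.sum_le_sum fun S hS => ?_)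
    (Finset.sum_le_sum_of_subset_of_nonneg (Finset.filter_subset _ _) fun S _ _ => by positivity)
  rw [mul_comm]
  gcongr
  exact (Finset.mem_filter.1 hS).2.le

/-- The level inequality for the derivative in direction `i`. The extra factor `√(influence i f)` is
what allows a sum over arbitrarily many weak coordinates. -/
theorem sum_mem_fourierCoeff_le {f : Cube d → ℝ} (hf : ∀ x, f x ∈ Set.Icc (0 : ℝ) 1) (k : ℕ)
    (i : Fin d) :
    ∑ S : Finset (Fin d) with i ∈ S ∧ S.card ≤ k, fourierCoeff f S ^ 2 ≤
      3 ^ k * influence i f * √(influence i f) / 4 := by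
  rw [influence_eq, le_div_iff₀ (by norm_num), Finset.sum_mul]
  refine le_trans ?_ (sum_fourierCoeff_sq_le k _ (abs_sub_flip_le_one hf i))
  refine le_trans (Finset.sum_le_sum fun S hS => ?_)
    (Finset.sum_le_sum_of_subset_of_nonneg
      (t := Finset.univ.filter fun S : Finset (Fin d) => S.card ≤ k) ?_ fun S _ _ => sq_nonneg _)
  · rw [fourierCoeff_sub_flip f (Finset.mem_filter.1 hS).2.1]
    exact le_of_eq (by ring)
  · exact Finset.monotone_filter_right _ fun S _ hS => hS.2

/-- The subsets of `J` with at most `k` elements. -/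
def lowSubsets (J : Finset (Fin d)) (k : ℕ) : Finset (Finset (Fin d)) :=
  J.powerset.filter fun S => S.card ≤ k

theorem mem_lowSubsets {J : Finset (Fin d)} {k : ℕ} {S : Finset (Fin d)} :
    S ∈ lowSubsets J k ↔ S ⊆ J ∧ S.card ≤ k := by
  simp [lowSubsets]

theorem lowSubsets_mono {J J' : Finset (Fin d)} (h : J ⊆ J') (k : ℕ) :
    lowSubsets J k ⊆ lowSubsets J' k := fun S hS => by
  rw [mem_lowSubsets] at *
  exact ⟨hS.1.trans h, hS.2⟩

/-- The truncation bias of the Fourier series. -/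
theorem sum_notMem_lowSubsets_le {f : Cube d → ℝ} (hf : ∀ x, f x ∈ Set.Icc (0 : ℝ) 1) {k : ℕ}
    (hk : 0 < k) {J : Finset (Fin d)} {δ : ℝ} (hJ : ∀ i ∉ J, influence i f ≤ δ) :
    ∑ S ∈ (lowSubsets J k)ᶜ, fourierCoeff f S ^ 2 ≤
      totalInfluence f / (4 * k) + 3 ^ k * √δ * totalInfluence f / 4 := by
  have hsplit : ∑ S ∈ (lowSubsets J k)ᶜ, fourierCoeff f S ^ 2 ≤
      ∑ S : Finset (Fin d) with k < S.card, fourierCoeff f S ^ 2 +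
        ∑ S : Finset (Fin d) with ¬S ⊆ J ∧ S.card ≤ k, fourierCoeff f S ^ 2 := by
    rw [← Finset.sum_union_inter]
    refine le_add_of_le_of_nonneg (Finset.sum_le_sum_of_subset_of_nonneg (fun S hS => ?_)
      fun S _ _ => sq_nonneg _) (Finset.sum_nonneg fun S _ => sq_nonneg _)
    rw [Finset.mem_compl, mem_lowSubsets] at hS
    simp only [Finset.mem_union, Finset.mem_filter, Finset.mem_univ, true_and]
    by_cases h : S.card ≤ k
    · exact Or.inr ⟨fun h' => hS ⟨h', h⟩, h⟩
    · exact Or.inl (not_le.1 h)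
  refine hsplit.trans (add_le_add (sum_card_gt_fourierCoeff_le hf hk) ?_)
  calc ∑ S : Finset (Fin d) with ¬S ⊆ J ∧ S.card ≤ k, fourierCoeff f S ^ 2
      -- Each set not contained in `J` is charged to one of its elements outside `J`.
      ≤ ∑ i ∈ Jᶜ, ∑ S : Finset (Fin d) with i ∈ S ∧ S.card ≤ k, fourierCoeff f S ^ 2 := by
        simp only [Finset.sum_filter]
        rw [Finset.sum_comm]
        refine Finset.sum_le_sum fun S _ => ?_
        have hnn : ∀ i ∈ Jᶜ, 0 ≤ if i ∈ S ∧ S.card ≤ k then fourierCoeff f S ^ 2 else 0 :=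
          fun i _ => by split_ifs <;> positivity
        split_ifs with h
        · obtain ⟨i, hi, hiJ⟩ := Finset.not_subset.1 h.1
          refine le_trans ?_ (Finset.single_le_sum hnn (Finset.mem_compl.2 hiJ))
          rw [if_pos ⟨hi, h.2⟩]
        · exact Finset.sum_nonneg hnn
    _ ≤ ∑ i ∈ Jᶜ, 3 ^ k * √δ / 4 * influence i f := by
        refine Finset.sum_le_sum fun i hi => (sum_mem_fourierCoeff_le hf k i).trans ?_
        have h1 := Real.sqrt_le_sqrt (hJ i (Finset.mem_compl.1 hi))
        have h2 := influence_nonneg i f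
        calc _ ≤ 3 ^ k * influence i f * √δ / 4 := by gcongr
          _ = _ := by ring
    _ ≤ ∑ i, 3 ^ k * √δ / 4 * influence i f :=
        Finset.sum_le_sum_of_subset_of_nonneg (Finset.subset_univ _) fun i _ _ =>
          mul_nonneg (by positivity) (influence_nonneg i f)
    _ = _ := by rw [← Finset.mul_sum, totalInfluence]; ring

theorem normSq_partialSeries_sub (f : Cube d → ℝ) (𝒮 : Finset (Finset (Fin d)))
    (a : Finset (Fin d) → ℝ) :
    normSq (fun x => ∑ S ∈ 𝒮, a S * character S x - f x) =
      ∑ S ∈ 𝒮, (a S - fourierCoeff f S) ^ 2 + ∑ S ∈ 𝒮ᶜ, fourierCoeff f S ^ 2 := by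
  have h : ∀ x, ∑ S ∈ 𝒮, a S * character S x - f x
      = ∑ S, ((if S ∈ 𝒮 then a S else 0) - fourierCoeff f S) * character S x := by
    intro x
    simp only [sub_mul, Finset.sum_sub_distrib, fourier_inversion, ite_mul, zero_mul,
      Finset.sum_ite_mem, Finset.univ_inter]
  simp only [h, normSq_fourierSeries]
  rw [← Finset.sum_add_sum_compl 𝒮]
  congr 1
  · exact Finset.sum_congr rfl fun S hS => by rw [if_pos hS]
  · refine Finset.sum_congr rfl fun S hS => ?_
    rw [if_neg (Finset.mem_compl.1 hS)]; ring

theorem normSq_mono {g h : Cube d → ℝ} (H : ∀ x, |g x| ≤ |h x|) : normSq g ≤ normSq h :=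
  mean_mono fun x => sq_le_sq.2 (H x)

theorem normSq_nonneg (g : Cube d → ℝ) : 0 ≤ normSq g := mean_nonneg fun _ => sq_nonneg _

theorem abs_clamp_sub_le {u v : ℝ} (hv : v ∈ Set.Icc (0 : ℝ) 1) :
    |max 0 (min u 1) - v| ≤ |u - v| := by
  obtain ⟨h0, h1⟩ := hv
  rcases le_total u 1 with h | h
  · rw [min_eq_left h]
    rcases le_total 0 u with h' | h'
    · rw [max_eq_right h']
    · rw [max_eq_left h', abs_sub_comm, abs_sub_comm u, abs_of_nonneg (by linarith),
        abs_of_nonneg (by linarith)]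
      linarith
  · rw [min_eq_right h, max_eq_right zero_le_one, abs_of_nonneg (by linarith),
      abs_of_nonneg (by linarith)]
    linarith

theorem normSq_fourierEstimator_sub_le_one {n : ℕ} {f : Cube d → ℝ}
    (hf : ∀ x, f x ∈ Set.Icc (0 : ℝ) 1) (γ c₀ : ℝ) (D : Sample n d) :
    normSq (fun x => fourierEstimator γ c₀ D x - f x) ≤ 1 := by
  rw [← mean_const (d := d) 1]
  refine mean_mono fun x => ?_
  obtain ⟨h0, h1⟩ := hf x
  have h2 : 0 ≤ fourierEstimator γ c₀ D x := le_max_left _ _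
  have h3 : fourierEstimator γ c₀ D x ≤ 1 := max_le zero_le_one (min_le_right _ _)
  rw [sq_le_one_iff_abs_le_one, abs_le]
  constructor <;> linarith

theorem cutoff_pos (γ c₀ : ℝ) (n : ℕ) : 0 < cutoff γ c₀ n := lt_of_lt_of_le one_pos (le_max_right _ _)

/-- The error of the estimator when the selection step has succeeded. -/
theorem normSq_fourierEstimator_sub_le {n : ℕ} {f : Cube d → ℝ}
    (hf : ∀ x, f x ∈ Set.Icc (0 : ℝ) 1) (γ c₀ : ℝ) (D : Sample n d) {J : Finset (Fin d)} {δ : ℝ}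
    (hJ : selected γ c₀ D ⊆ J) (hδ : ∀ i ∉ selected γ c₀ D, influence i f ≤ δ) :
    normSq (fun x => fourierEstimator γ c₀ D x - f x) ≤
      ∑ S ∈ lowSubsets J (cutoff γ c₀ n), (empCoeff D S - fourierCoeff f S) ^ 2 +
        (totalInfluence f / (4 * cutoff γ c₀ n)
          + 3 ^ cutoff γ c₀ n * √δ * totalInfluence f / 4) := by
  refine (normSq_mono fun x => abs_clamp_sub_le (hf x)).trans ?_
  rw [normSq_partialSeries_sub]
  refine add_le_add ?_ (sum_notMem_lowSubsets_le hf (cutoff_pos γ c₀ n) hδ)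
  exact Finset.sum_le_sum_of_subset_of_nonneg (lowSubsets_mono hJ _) fun S _ _ => sq_nonneg _

/-- Chernoff-type counting: weight each set by `t ^ |S| ≥ t ^ k` and sum over all subsets with the
binomial theorem. The choice `t = δ` is made later, since `δ |J|` is then at most `4K`. -/
theorem card_lowSubsets_le (J : Finset (Fin d)) (k : ℕ) {t : ℝ} (h0 : 0 < t) (h1 : t ≤ 1) :
    ((lowSubsets J k).card : ℝ) ≤ Real.exp (t * J.card) / t ^ k := by
  rw [le_div_iff₀ (by positivity), ← nsmul_eq_mul, ← Finset.sum_const]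
  calc ∑ _S ∈ lowSubsets J k, t ^ k ≤ ∑ S ∈ lowSubsets J k, t ^ S.card :=
        Finset.sum_le_sum fun S hS => pow_le_pow_of_le_one h0.le h1 (mem_lowSubsets.1 hS).2
    _ ≤ ∑ S ∈ J.powerset, t ^ S.card :=
        Finset.sum_le_sum_of_subset_of_nonneg (Finset.filter_subset _ _) fun S _ _ => by positivity
    _ = (1 + t) ^ J.card := by
        rw [← Finset.prod_const, Finset.prod_one_add]
        simp
    _ ≤ Real.exp t ^ J.card := by
        gcongr
        linarith [Real.add_one_le_exp t]
    _ = _ := by rw [← Real.exp_nat_mul, mul_comm]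

theorem card_influential_le (f : Cube d → ℝ) {η : ℝ} (hη : 0 < η) :
    ((Finset.univ.filter fun i => η ≤ influence i f).card : ℝ) ≤ totalInfluence f / η := by
  rw [le_div_iff₀ hη, ← nsmul_eq_mul, ← Finset.sum_const]
  refine (Finset.sum_le_sum fun i hi => (Finset.mem_filter.1 hi).2).trans ?_
  exact Finset.sum_le_sum_of_subset_of_nonneg (Finset.filter_subset _ _) fun i _ _ =>
    influence_nonneg i f

end Bias

open MeasureTheory ProbabilityTheory

/-! ### Representation of the sample by design points and noise. -/

section Law

variable {n d : ℕ}

instance isProbabilityMeasure_unif : IsProbabilityMeasure (unif d) := by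
  unfold unif; infer_instance

theorem unif_real_singleton (x : Cube d) : (unif d).real {x} = 1 / 2 ^ d := by
  simp [unif, uniformOn_univ, Measure.real]

theorem integral_unif (g : Cube d → ℝ) : ∫ x, g x ∂(unif d) = mean g := by
  rw [integral_fintype (Integrable.of_finite)]
  simp only [unif_real_singleton, smul_eq_mul, ← Finset.mul_sum, mean]
  ring

/-- The joint law of the design points and the noise variables. -/
def designNoiseLaw (d : ℕ) (ν : Fin n → Measure ℝ) : Measure (Fin n → Cube d × ℝ) :=
  Measure.pi fun j => (unif d).prod (ν j)

/-- The sample produced by the design points and the noise variables. -/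
def observe (f : Cube d → ℝ) (p : Fin n → Cube d × ℝ) : Sample n d :=
  fun j => ((p j).1, f (p j).1 + (p j).2)

theorem measurable_cube_comp_fst (f : Cube d → ℝ) : Measurable fun p : Cube d × ℝ => f p.1 :=
  (measurable_of_finite f).comp measurable_fst

theorem measurable_observe (f : Cube d → ℝ) : Measurable (observe (n := n) f) := by
  refine measurable_pi_lambda _ fun j => ?_
  have h := (measurable_cube_comp_fst f).comp (measurable_pi_apply (X := fun _ => Cube d × ℝ) j)
  exact Measurable.prodMk (by fun_prop) (h.add (by fun_prop))

variable (ν : Fin n → Measure ℝ) [∀ j, IsProbabilityMeasure (ν j)]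

instance isProbabilityMeasure_designNoiseLaw : IsProbabilityMeasure (designNoiseLaw d ν) := by
  unfold designNoiseLaw; infer_instance

/-- This couples the samples for all `f` on one probability space. The lower bound relies on it: the
function varies while the design and the noise stay fixed. -/
theorem sampleLaw_eq_map (f : Cube d → ℝ) :
    sampleLaw ν f = (designNoiseLaw d ν).map (observe f) := by
  have hm : Measurable fun p : Cube d × ℝ => (p.1, f p.1 + p.2) :=
    measurable_fst.prodMk ((measurable_cube_comp_fst f).add measurable_snd)
  have : ∀ j, IsProbabilityMeasure
      (((unif d).prod (ν j)).map fun p : Cube d × ℝ => (p.1, f p.1 + p.2)) := fun j =>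
    Measure.isProbabilityMeasure_map hm.aemeasurable
  exact (Measure.pi_map_pi fun j => hm.aemeasurable).symm

theorem measurable_loss {g : Sample n d → Cube d → ℝ} (hg : Measurable g) (f : Cube d → ℝ) :
    Measurable fun D => ENNReal.ofReal (normSq fun x => g D x - f x) := by
  unfold normSq mean
  have : ∀ x, Measurable fun D => g D x := fun x => (measurable_pi_apply x).comp hg
  fun_prop

theorem risk_eq {g : Sample n d → Cube d → ℝ} (hg : Measurable g) (f : Cube d → ℝ) :
    risk ν g f = ∫⁻ p, ENNReal.ofReal (normSq fun x => g (observe f p) x - f x)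
      ∂(designNoiseLaw d ν) := by
  rw [risk, sampleLaw_eq_map, lintegral_map (measurable_loss hg f) (measurable_observe f)]

end Law

/-! ### Measurability of the estimator. -/

section Estimator

variable {n d : ℕ}

theorem measurable_obs_fst (j : Fin n) : Measurable fun D : Sample n d => (D j).1 := by fun_prop

theorem measurable_obs_snd (j : Fin n) : Measurable fun D : Sample n d => (D j).2 := by fun_prop

theorem measurable_condMean (i : Fin d) (b : Bool) :
    Measurable fun D : Sample n d => condMean D i b := by
  have h : ∀ D : Sample n d, condMean D i b =
      (∑ j ∈ firstHalf n, if (D j).1 i = b then (D j).2 else 0) /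
        ∑ j ∈ firstHalf n, if (D j).1 i = b then (1 : ℝ) else 0 := by
    intro D
    rw [condMean, Finset.sum_filter, Finset.card_filter]
    push_cast
    rfl
  simp only [h]
  have hs : ∀ j, MeasurableSet {D : Sample n d | (D j).1 i = b} := fun j =>
    measurableSet_eq_fun (by fun_prop) measurable_const
  refine Measurable.div (Finset.measurable_sum _ fun j _ => ?_)
    (Finset.measurable_sum _ fun j _ => ?_)
  · exact Measurable.ite (hs j) (by fun_prop) measurable_const
  · exact Measurable.ite (hs j) measurable_const measurable_const

theorem measurable_empInfluence (i : Fin d) :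
    Measurable fun D : Sample n d => empInfluence D i :=
  (measurable_condMean i true).sub (measurable_condMean i false)

theorem measurable_empCoeff (S : Finset (Fin d)) :
    Measurable fun D : Sample n d => empCoeff D S := by
  unfold empCoeff
  refine (Finset.measurable_sum _ fun j _ => ?_).div_const _
  exact (measurable_obs_snd j).mul
    ((measurable_of_finite (character S)).comp (measurable_obs_fst j))

theorem measurable_fourierEstimator (γ c₀ : ℝ) :
    Measurable (fourierEstimator (n := n) (d := d) γ c₀) := by
  refine measurable_pi_lambda _ fun x => ?_
  have hS : ∀ S : Finset (Fin d), MeasurableSet {D : Sample n d |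
      ∀ i ∈ S, threshold γ c₀ n / 2 ≤ empInfluence D i} := by
    intro S
    have : {D : Sample n d | ∀ i ∈ S, threshold γ c₀ n / 2 ≤ empInfluence D i}
        = ⋂ i ∈ S, {D : Sample n d | threshold γ c₀ n / 2 ≤ empInfluence D i} := by
      ext; simp
    rw [this]
    exact Finset.measurableSet_biInter _ fun i _ =>
      measurableSet_le measurable_const (measurable_empInfluence i)
  -- The random index family is replaced by a fixed one with measurable indicators.
  have h : ∀ D : Sample n d,
      ∑ S ∈ (selected γ c₀ D).powerset.filter (fun S => S.card ≤ cutoff γ c₀ n),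
        empCoeff D S * character S x =
      ∑ S : Finset (Fin d) with S.card ≤ cutoff γ c₀ n,
        if ∀ i ∈ S, threshold γ c₀ n / 2 ≤ empInfluence D i then
          empCoeff D S * character S x else 0 := by
    intro D
    rw [← Finset.sum_filter]
    refine Finset.sum_congr ?_ fun _ _ => rfl
    ext S
    simp only [Finset.mem_filter, Finset.mem_powerset, Finset.mem_univ, true_and,
      Finset.subset_iff, selected]
    tauto
  simp only [fourierEstimator, h]
  refine measurable_const.max (Measurable.min (Finset.measurable_sum _ fun S _ => ?_)
    measurable_const)
  exact Measurable.ite (hS S) ((measurable_empCoeff S).mul_const _) measurable_const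

end Estimator

/-! ### Moments and subgaussianity of the weighted responses. -/

section Moments

variable {d : ℕ} {σ : ℝ≥0} {ν : Measure ℝ}

theorem memLp_two_of_subgaussian (h : HasSubgaussianMGF (fun e : ℝ => e) (σ ^ 2) ν) :
    MemLp (fun e : ℝ => e) 2 ν := by
  have := h.memLp 2
  rwa [ENNReal.coe_ofNat] at this

theorem sq_le_exp_add_exp_neg (x : ℝ) : x ^ 2 ≤ 2 * (Real.exp x + Real.exp (-x)) := by
  have h : ∀ y : ℝ, 0 ≤ y → y ^ 2 ≤ 2 * (Real.exp y + Real.exp (-y)) := fun y hy => by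
    nlinarith [Real.quadratic_le_exp_of_nonneg hy, Real.exp_pos (-y)]
  rcases le_total 0 x with hx | hx
  · exact h x hx
  · have := h (-x) (by linarith)
    rw [neg_neg, neg_sq] at this
    linarith

theorem integral_sq_le_of_subgaussian (h : HasSubgaussianMGF (fun e : ℝ => e) (σ ^ 2) ν) :
    ∫ e, e ^ 2 ∂ν ≤ 4 * Real.exp (σ ^ 2 / 2) := by
  have i1 := h.integrable_exp_mul 1
  have i2 := h.integrable_exp_mul (-1)
  have h1 := h.mgf_le 1
  have h2 := h.mgf_le (-1)
  simp only [mgf, NNReal.coe_pow, one_pow, mul_one, even_two, Even.neg_pow] at h1 h2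
  calc ∫ e, e ^ 2 ∂ν ≤ ∫ e, 2 * (Real.exp (1 * e) + Real.exp (-1 * e)) ∂ν := by
        refine integral_mono ((memLp_two_of_subgaussian h).integrable_sq)
          ((i1.add i2).const_mul 2) fun e => ?_
        simp only [one_mul, neg_one_mul]
        exact sq_le_exp_add_exp_neg e
    _ ≤ _ := by
        rw [integral_const_mul, integral_add i1 i2]
        linarith

/-- A uniform bound on the second moment of `1 + |ε|`. -/
def momentBound (σ : ℝ≥0) : ℝ := 2 + 8 * Real.exp (σ ^ 2 / 2)

variable {f : Cube d → ℝ} [IsProbabilityMeasure ν]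

theorem memLp_weighted_response (hν : HasSubgaussianMGF (fun e : ℝ => e) (σ ^ 2) ν)
    (hf : ∀ x, f x ∈ Set.Icc (0 : ℝ) 1) {w : Cube d → ℝ} (hw : ∀ x, |w x| ≤ 1) :
    MemLp (fun p : Cube d × ℝ => (f p.1 + p.2) * w p.1) 2 ((unif d).prod ν) ∧
      ∫ p, ((f p.1 + p.2) * w p.1) ^ 2 ∂((unif d).prod ν) ≤ momentBound σ := by
  have hm : Measurable fun p : Cube d × ℝ => (f p.1 + p.2) * w p.1 :=
    ((measurable_cube_comp_fst f).add measurable_snd).mul (measurable_cube_comp_fst w)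
  have h2 : MemLp (fun p : Cube d × ℝ => p.2) 2 ((unif d).prod ν) :=
    (memLp_two_of_subgaussian hν).comp_snd _
  have hb : ∀ p : Cube d × ℝ, |(f p.1 + p.2) * w p.1| ≤ 1 + |p.2| := by
    intro p
    rw [abs_mul]
    refine (mul_le_of_le_one_right (abs_nonneg _) (hw _)).trans ((abs_add_le _ _).trans ?_)
    gcongr
    rw [abs_of_nonneg (hf _).1]
    exact (hf _).2
  have hd : MemLp (fun p : Cube d × ℝ => 1 + |p.2|) 2 ((unif d).prod ν) :=
    (memLp_const (1 : ℝ)).add h2.abs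
  have hZ : MemLp (fun p : Cube d × ℝ => (f p.1 + p.2) * w p.1) 2 ((unif d).prod ν) :=
    hd.of_le hm.aestronglyMeasurable (Filter.Eventually.of_forall fun p => by
      rw [Real.norm_eq_abs, Real.norm_of_nonneg (by positivity)]; exact hb p)
  refine ⟨hZ, ?_⟩
  calc ∫ p, ((f p.1 + p.2) * w p.1) ^ 2 ∂((unif d).prod ν)
      ≤ ∫ p, (2 + 2 * p.2 ^ 2) ∂((unif d).prod ν) := by
        refine integral_mono hZ.integrable_sq
          ((integrable_const _).add (h2.integrable_sq.const_mul 2)) fun p => ?_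
        have h3 := sq_le_sq' (by linarith [abs_nonneg ((f p.1 + p.2) * w p.1), abs_nonneg p.2])
          (hb p)
        simp only [sq_abs] at h3
        nlinarith [sq_nonneg (1 - |p.2|), sq_abs p.2]
    _ = 2 + 2 * ∫ e, e ^ 2 ∂ν := by
        rw [integral_add (integrable_const _) (h2.integrable_sq.const_mul 2), integral_const_mul,
          integral_fun_snd (fun e : ℝ => e ^ 2)]
        simp
    _ ≤ _ := by
        rw [momentBound]
        linarith [integral_sq_le_of_subgaussian hν]

theorem integral_weighted_response (hν : HasSubgaussianMGF (fun e : ℝ => e) (σ ^ 2) ν)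
    (hν0 : ∫ e, e ∂ν = 0) (w : Cube d → ℝ) :
    ∫ p, (f p.1 + p.2) * w p.1 ∂((unif d).prod ν) = mean fun x => f x * w x := by
  have i1 : Integrable (fun p : Cube d × ℝ => f p.1 * w p.1) ((unif d).prod ν) :=
    (Integrable.of_finite (f := fun x => f x * w x) (μ := unif d)).comp_fst ν
  have i2 : Integrable (fun p : Cube d × ℝ => w p.1 * p.2) ((unif d).prod ν) :=
    (Integrable.of_finite (f := w) (μ := unif d)).mul_prod hν.integrable
  have h : ∀ p : Cube d × ℝ, (f p.1 + p.2) * w p.1 = f p.1 * w p.1 + w p.1 * p.2 := fun p => by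
    ring
  simp only [h]
  rw [integral_add i1 i2, integral_prod_mul w (fun e => e), hν0,
    integral_fun_fst (fun x => f x * w x), integral_unif]
  simp

/-- Given the design point, the weight only rescales the argument `t` of the moment generating
function by a factor in `[0, 1]`; the bound then survives averaging over the design. -/
theorem hasSubgaussianMGF_weighted_noise (hν : HasSubgaussianMGF (fun e : ℝ => e) (σ ^ 2) ν)
    {w : Cube d → ℝ} (hw : ∀ x, w x ∈ Set.Icc (0 : ℝ) 1) :
    HasSubgaussianMGF (fun p : Cube d × ℝ => p.2 * w p.1) (σ ^ 2) ((unif d).prod ν) := by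
  have hint : ∀ t, Integrable (fun p : Cube d × ℝ => Real.exp (t * (p.2 * w p.1)))
      ((unif d).prod ν) := by
    intro t
    have i1 : Integrable (fun p : Cube d × ℝ => Real.exp (t * p.2) + 1) ((unif d).prod ν) :=
      ((hν.integrable_exp_mul t).comp_snd _).add (integrable_const 1)
    refine i1.mono' ?_ (Filter.Eventually.of_forall fun p => ?_)
    · exact (Real.measurable_exp.comp (measurable_const.mul
        (measurable_snd.mul (measurable_cube_comp_fst w)))).aestronglyMeasurable
    · rw [Real.norm_of_nonneg (Real.exp_pos _).le]
      obtain ⟨h0, h1⟩ := hw p.1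
      rw [← mul_assoc]
      rcases le_total 0 (t * p.2) with h | h
      · have := Real.exp_le_exp.2 (mul_le_of_le_one_right h h1)
        linarith
      · have := Real.exp_le_one_iff.2 (mul_nonpos_of_nonpos_of_nonneg h h0)
        linarith [Real.exp_pos (t * p.2)]
  refine ⟨hint, fun t => ?_⟩
  rw [mgf, integral_prod _ (hint t)]
  have h : ∀ x, ∫ e, Real.exp (t * (e * w x)) ∂ν ≤ Real.exp (((σ ^ 2 : ℝ≥0) : ℝ) * t ^ 2 / 2) := by
    intro x
    have h1 := hν.mgf_le (t * w x)
    have h2 : ∀ e, t * w x * e = t * (e * w x) := fun e => by ring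
    simp only [mgf, h2] at h1
    refine h1.trans (Real.exp_le_exp.2 ?_)
    obtain ⟨h3, h4⟩ := hw x
    rw [mul_pow]
    gcongr
    exact mul_le_of_le_one_right (sq_nonneg t) (pow_le_one₀ h3 h4)
  rw [integral_unif]
  exact (mean_mono h).trans (mean_const _).le

end Moments

/-! ### Concentration and the selection of coordinates. -/

theorem card_firstHalf (n : ℕ) : (firstHalf n).card = n / 2 := by
  rw [firstHalf, Fin.card_filter_val_lt, min_eq_right (Nat.div_le_self _ _)]

theorem card_secondHalf (n : ℕ) : (secondHalf n).card = n - n / 2 := by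
  have h := Finset.card_filter_add_card_filter_not (s := (Finset.univ : Finset (Fin n)))
    (fun j => (j : ℕ) < n / 2)
  have h1 := card_firstHalf n
  simp only [firstHalf] at h1
  simp only [not_lt] at h
  rw [h1, Finset.card_univ, Fintype.card_fin] at h
  rw [secondHalf]
  omega

/-- Two-sided Hoeffding bound on a product space. -/
theorem measure_abs_sum_ge_le {n : ℕ} {α : Type*} [MeasurableSpace α] (μ : Fin n → Measure α)
    [∀ j, IsProbabilityMeasure (μ j)] {U : α → ℝ} (hU : Measurable U) {c : ℝ≥0}
    (hc : ∀ j, HasSubgaussianMGF U c (μ j)) (s : Finset (Fin n)) {η : ℝ} (hη : 0 ≤ η) :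
    (Measure.pi μ).real {p | s.card * η ≤ |∑ j ∈ s, U (p j)|} ≤
      2 * Real.exp (-(s.card * η ^ 2 / (2 * c))) := by
  have key : ∀ V : α → ℝ, Measurable V → (∀ j, HasSubgaussianMGF V c (μ j)) →
      (Measure.pi μ).real {p | s.card * η ≤ ∑ j ∈ s, V (p j)} ≤
        Real.exp (-(s.card * η ^ 2 / (2 * c))) := by
    intro V hV hVc
    have hind : iIndepFun (fun j (p : Fin n → α) => V (p j)) (Measure.pi μ) :=
      iIndepFun_pi fun j => hV.aemeasurable
    have hsub : ∀ j ∈ s, HasSubgaussianMGF (fun p : Fin n → α => V (p j)) c (Measure.pi μ) := by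
      intro j _
      refine HasSubgaussianMGF.of_map (X := V) (Y := fun p : Fin n → α => p j)
        (measurable_pi_apply j).aemeasurable ?_
      rw [(measurePreserving_eval μ j).map_eq]
      exact hVc j
    refine (HasSubgaussianMGF.measure_sum_ge_le_of_iIndepFun hind hsub
      (mul_nonneg (Nat.cast_nonneg _) hη)).trans (le_of_eq ?_)
    rw [Finset.sum_const, nsmul_eq_mul]
    congr 1
    rcases s.eq_empty_or_nonempty with rfl | hs
    · simp
    · have : (s.card : ℝ) ≠ 0 := by exact_mod_cast hs.card_ne_zero
      rw [neg_div, mul_pow, sq (s.card : ℝ), mul_assoc, NNReal.coe_mul, NNReal.coe_natCast,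
        mul_left_comm (2 : ℝ), mul_div_mul_left _ _ this]
  have h1 := key U hU hc
  have h2 := key (fun a => -U a) hU.neg fun j => (hc j).neg
  calc _ ≤ (Measure.pi μ).real ({p | s.card * η ≤ ∑ j ∈ s, U (p j)} ∪
        {p | s.card * η ≤ ∑ j ∈ s, -U (p j)}) := by
        refine measureReal_mono fun p hp => ?_
        simp only [Set.mem_ofPred_eq, Set.mem_union, Finset.sum_neg_distrib] at hp ⊢
        exact le_abs.1 hp
    _ ≤ _ := (measureReal_union_le _ _).trans (by linarith)

section Selection

variable {n d : ℕ} {σ : ℝ≥0} {f : Cube d → ℝ}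

/-- The indicator of `x i = b`. -/
def coordIndicator (i : Fin d) (b : Bool) (x : Cube d) : ℝ := if x i = b then 1 else 0

/-- The conditional mean of `f` given that coordinate `i` equals `b`. -/
def faceMean (f : Cube d → ℝ) (i : Fin d) (b : Bool) : ℝ :=
  mean fun x => f (Function.update x i b)

theorem coordIndicator_mem (i : Fin d) (b : Bool) (x : Cube d) :
    coordIndicator i b x ∈ Set.Icc (0 : ℝ) 1 := by
  unfold coordIndicator; split_ifs <;> simp

theorem mean_mul_coordIndicator (f : Cube d → ℝ) (i : Fin d) (b : Bool) :
    mean (fun x => f x * coordIndicator i b x) = faceMean f i b / 2 := by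
  rw [mean_eq_half_flip i, faceMean]
  congr 2
  ext x
  rw [update_eq_ite_flip]
  unfold coordIndicator
  by_cases h : x i = b
  · simp [h, flip]
  · have : (!x i) = b := by cases hx : x i <;> cases b <;> simp_all
    simp [h, flip, this]

theorem mean_coordIndicator (i : Fin d) (b : Bool) : mean (coordIndicator i b) = 1 / 2 := by
  have := mean_mul_coordIndicator (fun _ => (1 : ℝ)) i b
  simp only [one_mul, faceMean, mean_const] at this
  exact this

theorem faceMean_mem (hf : ∀ x, f x ∈ Set.Icc (0 : ℝ) 1) (i : Fin d) (b : Bool) :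
    faceMean f i b ∈ Set.Icc (0 : ℝ) 1 :=
  ⟨mean_nonneg fun _ => (hf _).1, (mean_mono fun _ => (hf _).2).trans (mean_const 1).le⟩

/-- Monotonicity removes the absolute value in the influence, which is why a difference of two
empirical means can estimate it. -/
theorem influence_eq_faceMean_sub (hf : Monotone f) (i : Fin d) :
    influence i f = faceMean f i true - faceMean f i false := by
  rw [faceMean, faceMean, ← mean_sub, influence]
  congr 1
  ext x
  refine abs_of_nonneg (sub_nonneg.2 (hf ?_))
  exact update_le_update_iff.2 ⟨by decide, fun j _ => le_rfl⟩

/-- The centred response on the face `x i = b`. -/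
def faceResidual (f : Cube d → ℝ) (i : Fin d) (b : Bool) (p : Cube d × ℝ) : ℝ :=
  (f p.1 + p.2 - faceMean f i b) * coordIndicator i b p.1

theorem measurable_faceResidual (f : Cube d → ℝ) (i : Fin d) (b : Bool) :
    Measurable (faceResidual f i b) :=
  (((measurable_cube_comp_fst f).add measurable_snd).sub_const _).mul
    (measurable_cube_comp_fst _)

/-- The residual is a centred variable in `[-1, 1]`, with parameter `1` by Hoeffding's lemma, plus
weighted noise with parameter `σ²`. Square roots of parameters add without independence, whence `(1
+ σ)²`. -/
theorem hasSubgaussianMGF_faceResidual {ν : Measure ℝ} [IsProbabilityMeasure ν]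
    (hν : HasSubgaussianMGF (fun e : ℝ => e) (σ ^ 2) ν) (hf : ∀ x, f x ∈ Set.Icc (0 : ℝ) 1)
    (i : Fin d) (b : Bool) :
    HasSubgaussianMGF (faceResidual f i b) ((1 + σ) ^ 2) ((unif d).prod ν) := by
  set g : Cube d → ℝ := fun x => (f x - faceMean f i b) * coordIndicator i b x with hg
  have hm := faceMean_mem hf i b
  have h1 : HasSubgaussianMGF (fun p : Cube d × ℝ => g p.1) 1 ((unif d).prod ν) := by
    have h := hasSubgaussianMGF_of_mem_Icc_of_integral_eq_zero (μ := (unif d).prod ν)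
      (X := fun p : Cube d × ℝ => g p.1) (a := -1) (b := 1)
      (measurable_cube_comp_fst g).aemeasurable
      (Filter.Eventually.of_forall fun p => by
        have h1 := hf p.1
        have h2 : |f p.1 - faceMean f i b| ≤ 1 := by
          rw [abs_le]; constructor <;> linarith [h1.1, h1.2, hm.1, hm.2]
        rw [Set.mem_Icc, ← abs_le, hg, abs_mul,
          abs_of_nonneg (coordIndicator_mem i b p.1).1]
        exact mul_le_one₀ h2 (coordIndicator_mem i b p.1).1 (coordIndicator_mem i b p.1).2)
      (by
        rw [integral_fun_fst, integral_unif, hg]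
        simp only [sub_mul, mean_sub, mean_const_mul, mean_mul_coordIndicator,
          mean_coordIndicator]
        simp; ring)
    convert h using 1
    rw [show (1 : ℝ) - -1 = 2 by norm_num]
    ext; simp
  have h2 := hasSubgaussianMGF_weighted_noise hν (coordIndicator_mem i b)
  have h3 := h1.add h2
  rw [NNReal.sqrt_one, NNReal.sqrt_sq] at h3
  have h4 : faceResidual f i b
      = fun p : Cube d × ℝ => g p.1 + p.2 * coordIndicator i b p.1 := by
    ext p
    rw [faceResidual, hg]; ring
  rw [h4]
  exact h3

theorem hasSubgaussianMGF_coordIndicator {ν : Measure ℝ} [IsProbabilityMeasure ν]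
    (i : Fin d) (b : Bool) :
    HasSubgaussianMGF (fun p : Cube d × ℝ => coordIndicator i b p.1 - 1 / 2) (1 / 4)
      ((unif d).prod ν) := by
  have h := hasSubgaussianMGF_of_mem_Icc_of_integral_eq_zero (μ := (unif d).prod ν)
    (X := fun p : Cube d × ℝ => coordIndicator i b p.1 - 1 / 2) (a := -(1 / 2)) (b := 1 / 2)
    ((measurable_cube_comp_fst (coordIndicator i b)).sub_const _).aemeasurable
    (Filter.Eventually.of_forall fun p => by
      have := coordIndicator_mem i b p.1
      constructor <;> linarith [this.1, this.2])
    (by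
      rw [integral_fun_fst (fun x => coordIndicator i b x - 1 / 2), integral_unif, mean_sub,
        mean_const, mean_coordIndicator]
      simp)
  convert h using 1
  rw [show (1 / 2 : ℝ) - -(1 / 2) = 1 by norm_num]
  ext; norm_num

/-- The event that the first half of the sample determines the mean on the face `x i = b` only up
to an error larger than `δ/8`. -/
def faceFailure (f : Cube d → ℝ) (δ : ℝ) (i : Fin d) (b : Bool) : Set (Fin n → Cube d × ℝ) :=
  {p | (firstHalf n).card * (δ / 32) ≤ |∑ j ∈ firstHalf n, faceResidual f i b (p j)|} ∪
    {p | (firstHalf n).card * (1 / 4) ≤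
      |∑ j ∈ firstHalf n, (coordIndicator i b (p j).1 - 1 / 2)|}

theorem abs_condMean_sub_lt {δ : ℝ} (hδ : 0 ≤ δ) {i : Fin d} {b : Bool}
    {p : Fin n → Cube d × ℝ} (hp : p ∉ faceFailure f δ i b) :
    |condMean (observe f p) i b - faceMean f i b| ≤ δ / 8 := by
  simp only [faceFailure, Set.mem_union, Set.mem_ofPred_eq, not_or, not_le] at hp
  obtain ⟨h1, h2⟩ := hp
  set s := (firstHalf n).filter fun j => (observe f p j).1 i = b with hs
  have hN : (s.card : ℝ) = ∑ j ∈ firstHalf n, coordIndicator i b (p j).1 := by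
    rw [hs, Finset.card_filter]
    push_cast
    rfl
  -- More than a quarter of the first half lies on the face, so dividing by `s.card` turns the error
  -- `δ / 32` into at most `δ / 8`. Strictness also excludes an empty face.
  have hcard : (firstHalf n).card * (1 / 4) < (s.card : ℝ) := by
    rw [hN]
    rw [Finset.sum_sub_distrib, Finset.sum_const, nsmul_eq_mul, abs_lt] at h2
    linarith
  have hpos : (0 : ℝ) < s.card := lt_of_le_of_lt (by positivity) hcard
  have hsum : ∑ j ∈ firstHalf n, faceResidual f i b (p j)
      = ∑ j ∈ s, (observe f p j).2 - s.card * faceMean f i b := by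
    rw [← nsmul_eq_mul, ← Finset.sum_const, ← Finset.sum_sub_distrib, hs, Finset.sum_filter]
    refine Finset.sum_congr rfl fun j _ => ?_
    by_cases h : (p j).1 i = b <;> simp [faceResidual, coordIndicator, observe, h]
  rw [condMean, ← hs, div_sub' hpos.ne', abs_div, abs_of_pos hpos, div_le_iff₀ hpos, ← hsum]
  refine h1.le.trans ?_
  have := mul_le_mul_of_nonneg_right hcard.le hδ
  linarith

theorem mem_selected {γ c₀ : ℝ} {D : Sample n d} {i : Fin d} :
    i ∈ selected γ c₀ D ↔ threshold γ c₀ n / 2 ≤ empInfluence D i := by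
  simp [selected]

/-- Two errors of `δ / 8` put the empirical influence within `δ / 4` of the true one, and the
comparison is with `δ / 2`. -/
theorem selected_of_notMem_faceFailure {γ c₀ : ℝ} (hf : Monotone f) {p : Fin n → Cube d × ℝ}
    (hp : ∀ i b, p ∉ faceFailure f (threshold γ c₀ n) i b) (i : Fin d) :
    (i ∈ selected γ c₀ (observe f p) → threshold γ c₀ n / 4 ≤ influence i f) ∧
      (i ∉ selected γ c₀ (observe f p) → influence i f ≤ threshold γ c₀ n) := by
  have hδ : 0 < threshold γ c₀ n := Real.exp_pos _
  have h1 := abs_le.1 (abs_condMean_sub_lt hδ.le (hp i true))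
  have h2 := abs_le.1 (abs_condMean_sub_lt hδ.le (hp i false))
  rw [influence_eq_faceMean_sub hf]
  rw [mem_selected, empInfluence, not_le]
  constructor <;> intro h <;> linarith [h1.1, h1.2, h2.1, h2.2]

theorem designNoiseLaw_faceFailure_le {ν : Fin n → Measure ℝ} [∀ j, IsProbabilityMeasure (ν j)]
    (hν : ∀ j, HasSubgaussianMGF (fun e : ℝ => e) (σ ^ 2) (ν j))
    (hf : ∀ x, f x ∈ Set.Icc (0 : ℝ) 1) {δ : ℝ} (h0 : 0 ≤ δ) (h1 : δ ≤ 1) (i : Fin d)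
    (b : Bool) :
    (designNoiseLaw d ν).real (faceFailure f δ i b) ≤
      4 * Real.exp (-((n / 2 : ℕ) * δ ^ 2 / (2048 * (1 + σ) ^ 2))) := by
  have e1 := measure_abs_sum_ge_le (fun j => (unif d).prod (ν j)) (measurable_faceResidual f i b)
    (fun j => hasSubgaussianMGF_faceResidual (hν j) hf i b) (firstHalf n)
    (η := δ / 32) (by positivity)
  have e2 := measure_abs_sum_ge_le (fun j => (unif d).prod (ν j))
    ((measurable_cube_comp_fst (coordIndicator i b)).sub_const (1 / 2))
    (fun j => hasSubgaussianMGF_coordIndicator i b) (firstHalf n)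
    (η := 1 / 4) (by positivity)
  refine (measureReal_union_le _ _).trans ((add_le_add e1 e2).trans ?_)
  rw [card_firstHalf]
  have hσ : (1 : ℝ) ≤ (1 + σ) ^ 2 := one_le_pow₀ (by linarith [σ.coe_nonneg])
  have l1 : Real.exp (-((n / 2 : ℕ) * (δ / 32) ^ 2 / (2 * ((1 + σ) ^ 2 : ℝ≥0))))
      = Real.exp (-((n / 2 : ℕ) * δ ^ 2 / (2048 * (1 + σ) ^ 2))) := by
    congr 2
    push_cast
    rw [div_pow, mul_div_assoc', div_div]
    congr 1
    ring
  -- The face count deviates with a probability exponent free of `δ`, which is larger than the first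
  -- one because `δ ≤ 1 ≤ 1 + σ`.
  have l2 : Real.exp (-((n / 2 : ℕ) * (1 / 4) ^ 2 / (2 * ((1 / 4 : ℝ≥0) : ℝ))))
      ≤ Real.exp (-((n / 2 : ℕ) * δ ^ 2 / (2048 * (1 + σ) ^ 2))) := by
    rw [Real.exp_le_exp, neg_le_neg_iff]
    push_cast
    rw [div_le_iff₀ (by positivity)]
    have h2 : δ ^ 2 ≤ 1 := pow_le_one₀ h0 h1
    have h3 : (0 : ℝ) ≤ (n / 2 : ℕ) := Nat.cast_nonneg _
    have h4 : ((n / 2 : ℕ) : ℝ) * δ ^ 2 ≤ (n / 2 : ℕ) := mul_le_of_le_one_right h3 h2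
    have h5 : ((n / 2 : ℕ) : ℝ) ≤ (n / 2 : ℕ) * (1 + σ) ^ 2 := le_mul_of_one_le_right h3 hσ
    have h6 : ((n / 2 : ℕ) : ℝ) * (1 / 4) ^ 2 / (2 * (1 / 4)) * (2048 * (1 + σ) ^ 2)
        = 256 * ((n / 2 : ℕ) * (1 + σ) ^ 2) := by ring
    rw [h6]
    linarith
  rw [l1]
  linarith

end Selection

/-! ### Nonasymptotic risk of the estimator. -/

section Risk

variable {n d : ℕ} {σ : ℝ≥0} {f : Cube d → ℝ} {ν : Fin n → Measure ℝ}

/-- The empirical coefficient is unbiased, so this is the variance of a mean of independent terms;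
the factor `2` reflects that the second half has at least `n / 2` observations. -/
theorem lintegral_empCoeff_sub_sq_le [∀ j, IsProbabilityMeasure (ν j)] (hn : 0 < n)
    (hν : ∀ j, HasSubgaussianMGF (fun e : ℝ => e) (σ ^ 2) (ν j)) (hν0 : ∀ j, ∫ e, e ∂(ν j) = 0)
    (hf : ∀ x, f x ∈ Set.Icc (0 : ℝ) 1) (S : Finset (Fin d)) :
    ∫⁻ p, ENNReal.ofReal ((empCoeff (observe f p) S - fourierCoeff f S) ^ 2)
      ∂(designNoiseLaw d ν) ≤ ENNReal.ofReal (2 * momentBound σ / n) := by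
  set Z : Cube d × ℝ → ℝ := fun p => (f p.1 + p.2) * character S p.1 with hZ
  have hmem := fun j => memLp_weighted_response (hν j) hf fun x => (abs_character S x).le
  have hint := fun j => integral_weighted_response (f := f) (hν j) (hν0 j) (character S)
  have hZm : ∀ j, MemLp (fun p : Fin n → Cube d × ℝ => Z (p j)) 2 (designNoiseLaw d ν) := fun j =>
    (hmem j).1.comp_measurePreserving
      (measurePreserving_eval (fun j => (unif d).prod (ν j)) j)
  have hind : iIndepFun (fun j (p : Fin n → Cube d × ℝ) => Z (p j)) (designNoiseLaw d ν) :=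
    iIndepFun_pi fun j => (hmem j).1.aestronglyMeasurable.aemeasurable
  have hvar : Var[∑ j ∈ secondHalf n, fun p => Z (p j); designNoiseLaw d ν]
      ≤ (secondHalf n).card * momentBound σ := by
    rw [IndepFun.variance_sum (fun j _ => hZm j) fun i _ j _ hij => hind.indepFun hij,
      ← nsmul_eq_mul, ← Finset.sum_const]
    refine Finset.sum_le_sum fun j _ => ?_
    refine (variance_le_expectation_sq (hZm j).aestronglyMeasurable).trans ?_
    refine le_trans (le_of_eq ?_) (hmem j).2
    exact integral_comp_eval (μ := fun j => (unif d).prod (ν j)) (i := j)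
      (f := fun p => Z p ^ 2) (hmem j).1.integrable_sq.aestronglyMeasurable
  set N : ℝ := ((secondHalf n).card : ℝ) with hN
  have hNn : (n : ℝ) / 2 ≤ N := by
    rw [hN, card_secondHalf, Nat.cast_sub (Nat.div_le_self _ _)]
    have : ((n / 2 : ℕ) : ℝ) ≤ n / 2 := Nat.cast_div_le
    linarith
  have hn' : (0 : ℝ) < n := by exact_mod_cast hn
  have hN0 : 0 < N := by linarith
  have hexp : ∫ p, (∑ j ∈ secondHalf n, fun p : Fin n → Cube d × ℝ => Z (p j)) p
      ∂(designNoiseLaw d ν) = N * fourierCoeff f S := by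
    simp only [Finset.sum_apply]
    rw [integral_finsetSum _ fun j _ => (hZm j).integrable one_le_two, hN, ← nsmul_eq_mul,
      ← Finset.sum_const]
    refine Finset.sum_congr rfl fun j _ => ?_
    refine Eq.trans ?_ (hint j)
    exact integral_comp_eval (μ := fun j => (unif d).prod (ν j)) (i := j)
      (f := Z) (hmem j).1.aestronglyMeasurable
  have hsum : MemLp (∑ j ∈ secondHalf n, fun p => Z (p j)) 2 (designNoiseLaw d ν) :=
    memLp_finsetSum' _ fun j _ => hZm j
  have hpt : ∀ p : Fin n → Cube d × ℝ, (empCoeff (observe f p) S - fourierCoeff f S) ^ 2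
      = ((∑ j ∈ secondHalf n, fun p : Fin n → Cube d × ℝ => Z (p j)) p
          - N * fourierCoeff f S) ^ 2 / N ^ 2 := by
    intro p
    rw [empCoeff, ← div_pow, sub_div, mul_div_cancel_left₀ _ hN0.ne', Finset.sum_apply]
    rfl
  have hvar' := variance_eq_integral (μ := designNoiseLaw d ν) hsum.aestronglyMeasurable.aemeasurable
  rw [hexp] at hvar'
  simp only [hpt]
  have hi : Integrable (fun p : Fin n → Cube d × ℝ =>
      ((∑ j ∈ secondHalf n, fun p : Fin n → Cube d × ℝ => Z (p j)) p
        - N * fourierCoeff f S) ^ 2 / N ^ 2) (designNoiseLaw d ν) :=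
    ((hsum.sub (memLp_const (N * fourierCoeff f S))).integrable_sq).div_const _
  rw [← ofReal_integral_eq_lintegral_ofReal hi
    (Filter.Eventually.of_forall fun p => by positivity), integral_div, ← hvar']
  refine ENNReal.ofReal_le_ofReal ?_
  calc _ ≤ N * momentBound σ / N ^ 2 := by gcongr
    _ = momentBound σ / N := by rw [sq, mul_div_mul_left _ _ hN0.ne']
    _ ≤ momentBound σ / (n / 2) := by
        have : 0 ≤ momentBound σ := by unfold momentBound; positivity
        gcongr
    _ = _ := by rw [div_div_eq_mul_div, mul_comm]

/-- A nonasymptotic bound on the risk of the Fourier thresholding estimator. -/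
theorem risk_fourierEstimator_le (hn : 0 < n) (hν : IsNoise σ ν) {γ c₀ K : ℝ} (hγ : 0 ≤ γ)
    (hf : f ∈ monotoneClass d K) :
    risk ν (fourierEstimator γ c₀) f ≤ ENNReal.ofReal
      (8 * d * Real.exp (-((n / 2 : ℕ) * threshold γ c₀ n ^ 2 / (2048 * (1 + σ) ^ 2)))
        + Real.exp (4 * K) / threshold γ c₀ n ^ cutoff γ c₀ n * (2 * momentBound σ / n)
        + (K / (4 * cutoff γ c₀ n) + 3 ^ cutoff γ c₀ n * √(threshold γ c₀ n) * K / 4)) := by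
  have := hν.isProbabilityMeasure
  obtain ⟨hf01, hmono, hK⟩ := hf
  set δ := threshold γ c₀ n with hδ
  set k := cutoff γ c₀ n with hk
  have hδ0 : 0 < δ := Real.exp_pos _
  have hδ1 : δ ≤ 1 := Real.exp_le_one_iff.2 (neg_nonpos.2 (by positivity))
  have hk0 : (0 : ℝ) < k := by exact_mod_cast cutoff_pos γ c₀ n
  have hK0 : 0 ≤ K := le_trans (Finset.sum_nonneg fun i _ => influence_nonneg i f) hK
  have hv : 0 ≤ momentBound σ := by unfold momentBound; positivity
  -- This deterministic set contains the selected coordinates off `bad`. Summing coefficient errors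
  -- over its subsets dominates the random sum, so expectations can be taken term by term without
  -- conditioning on the selection.
  set J : Finset (Fin d) := Finset.univ.filter fun i => δ / 4 ≤ influence i f with hJ
  set bad : Set (Fin n → Cube d × ℝ) := ⋃ i : Fin d, ⋃ b : Bool, faceFailure f δ i b with hbad
  set B : ℝ := K / (4 * k) + 3 ^ k * √δ * K / 4 with hB
  have hB0 : 0 ≤ B := by positivity
  have hpt : ∀ p, ENNReal.ofReal (normSq fun x => fourierEstimator γ c₀ (observe f p) x - f x) ≤
      bad.indicator (fun _ => 1) p + (∑ S ∈ lowSubsets J k,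
        ENNReal.ofReal ((empCoeff (observe f p) S - fourierCoeff f S) ^ 2)
          + ENNReal.ofReal B) := by
    intro p
    by_cases hp : p ∈ bad
    · rw [Set.indicator_of_mem hp]
      refine le_trans ?_ le_self_add
      rw [← ENNReal.ofReal_one]
      exact ENNReal.ofReal_le_ofReal (normSq_fourierEstimator_sub_le_one hf01 _ _ _)
    · have hp' : ∀ i b, p ∉ faceFailure f δ i b := by simpa [hbad] using hp
      have hsel := selected_of_notMem_faceFailure hmono hp'
      rw [Set.indicator_of_notMem hp, zero_add,
        ← ENNReal.ofReal_sum_of_nonneg fun S _ => sq_nonneg _,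
        ← ENNReal.ofReal_add (Finset.sum_nonneg fun S _ => sq_nonneg _) hB0]
      refine ENNReal.ofReal_le_ofReal ((normSq_fourierEstimator_sub_le hf01 γ c₀ _ (J := J)
        (fun i hi => ?_) fun i hi => (hsel i).2 hi).trans ?_)
      · exact Finset.mem_filter.2 ⟨Finset.mem_univ i, (hsel i).1 hi⟩
      · rw [← hk, ← hδ, hB]
        gcongr
  have hP : designNoiseLaw d ν bad ≤ ENNReal.ofReal
      (8 * d * Real.exp (-((n / 2 : ℕ) * δ ^ 2 / (2048 * (1 + σ) ^ 2)))) := by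
    rw [← ofReal_measureReal]
    refine ENNReal.ofReal_le_ofReal ?_
    refine (measureReal_iUnion_fintype_le _).trans ?_
    calc _ ≤ ∑ _i : Fin d, 8 * Real.exp (-((n / 2 : ℕ) * δ ^ 2 / (2048 * (1 + σ) ^ 2))) := by
          refine Finset.sum_le_sum fun i _ => ?_
          refine (measureReal_iUnion_fintype_le _).trans ?_
          rw [Fintype.sum_bool]
          have e1 := designNoiseLaw_faceFailure_le hν.subgaussian hf01 hδ0.le hδ1 i true
          have e2 := designNoiseLaw_faceFailure_le hν.subgaussian hf01 hδ0.le hδ1 i false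
          linarith
      _ = _ := by rw [Finset.sum_const, Finset.card_univ, Fintype.card_fin, nsmul_eq_mul]; ring
  have hcard : ((lowSubsets J k).card : ℝ) ≤ Real.exp (4 * K) / δ ^ k := by
    refine (card_lowSubsets_le J k hδ0 hδ1).trans ?_
    refine div_le_div_of_nonneg_right (Real.exp_le_exp.2 ?_) (by positivity)
    have h1 := card_influential_le f (η := δ / 4) (by positivity)
    rw [le_div_iff₀ (by positivity)] at h1
    have h2 : (J.card : ℝ) * (δ / 4) ≤ K := h1.trans hK
    linarith
  have hme : ∀ S, Measurable fun p : Fin n → Cube d × ℝ =>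
      ENNReal.ofReal ((empCoeff (observe f p) S - fourierCoeff f S) ^ 2) := fun S =>
    ((((measurable_empCoeff S).comp (measurable_observe f)).sub_const _).pow_const 2).ennreal_ofReal
  rw [risk_eq ν (measurable_fourierEstimator γ c₀), add_assoc, ENNReal.ofReal_add (by positivity)
    (by positivity), ENNReal.ofReal_add (by positivity) hB0]
  refine (lintegral_mono hpt).trans ?_
  have hme' : Measurable fun p : Fin n → Cube d × ℝ => ∑ S ∈ lowSubsets J k,
      ENNReal.ofReal ((empCoeff (observe f p) S - fourierCoeff f S) ^ 2) + ENNReal.ofReal B :=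
    (Finset.measurable_sum _ fun S _ => hme S).add_const _
  rw [lintegral_add_right _ hme',
    lintegral_add_right _ measurable_const, lintegral_finsetSum _ fun S _ => hme S,
    lintegral_const, measure_univ, mul_one]
  refine add_le_add ?_ (add_le_add ?_ le_rfl)
  · refine (lintegral_indicator_const_le _ _).trans ?_
    rwa [one_mul]
  · refine (Finset.sum_le_sum fun S _ => lintegral_empCoeff_sub_sq_le hn hν.subgaussian
      hν.centered hf01 S).trans ?_
    rw [Finset.sum_const, nsmul_eq_mul, ← ENNReal.ofReal_natCast,
      ← ENNReal.ofReal_mul (Nat.cast_nonneg _)]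
    exact ENNReal.ofReal_le_ofReal (mul_le_mul_of_nonneg_right hcard (by positivity))

theorem risk_fourierEstimator_le_one (hν : IsNoise σ ν) (γ c₀ : ℝ)
    (hf : ∀ x, f x ∈ Set.Icc (0 : ℝ) 1) :
    risk ν (fourierEstimator γ c₀) f ≤ 1 := by
  have := hν.isProbabilityMeasure
  rw [risk_eq ν (measurable_fourierEstimator γ c₀)]
  calc _ ≤ ∫⁻ _, 1 ∂(designNoiseLaw d ν) := lintegral_mono fun p =>
        ENNReal.ofReal_le_one.2 (normSq_fourierEstimator_sub_le_one hf _ _ _)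
    _ = 1 := by simp

end Risk

/-! ### Choice of constants and the upper rate. -/

section Asymptotics

variable {n : ℕ}

theorem exp_neg_le_inv {x : ℝ} (hx : 0 < x) : Real.exp (-x) ≤ 1 / x := by
  rw [Real.exp_neg, ← one_div]
  exact one_div_le_one_div_of_le hx (by linarith [Real.add_one_le_exp x])

theorem cutoff_le (hL : 9 * √(Real.log n) ≤ Real.log n) :
    (cutoff 4 9 n : ℝ) ≤ √(Real.log n - 9 * √(Real.log n)) / 2 + 1 := by
  have h2 : √((4 : ℝ)) = 2 := by
    rw [show (4 : ℝ) = 2 ^ 2 by norm_num]; exact Real.sqrt_sq (by norm_num)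
  have h3 : 0 ≤ Real.log n - 9 * √(Real.log n) := by linarith
  rw [cutoff, max_eq_left h3, Real.sqrt_div h3, h2, Nat.cast_max]
  refine max_le (Nat.ceil_lt_add_one (by positivity)).le ?_
  rw [Nat.cast_one]
  linarith [Real.sqrt_nonneg (Real.log n - 9 * √(Real.log n))]

/-- With `s = √(log n)`, the inequality `(s² - 9s) / 4 ≥ s² / 16` holds exactly from `s = 12` on. -/
theorem cutoff_ge (hs : 12 ≤ √(Real.log n)) : √(Real.log n) / 4 ≤ (cutoff 4 9 n : ℝ) := by
  set s := √(Real.log n) with hsd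
  have hL : Real.log n = s ^ 2 := by
    rw [hsd, Real.sq_sqrt]
    by_contra h
    rw [hsd, Real.sqrt_eq_zero_of_nonpos (not_le.1 h).le] at hs
    linarith
  rw [cutoff, Nat.cast_max, ← hsd, hL]
  refine le_trans ?_ (le_max_left _ _)
  refine le_trans ?_ (Nat.le_ceil _)
  refine Real.le_sqrt_of_sq_le ?_
  rw [max_eq_left (by nlinarith)]
  nlinarith

/-- This explains `c₀ = 9 = 4 + 4 + 1`: in the exponent, `4s` pays for rounding the cut-off up, `4s`
for `e^(4K)` with `K ≤ s`, and the last `s` leaves the gain `e^(-s) ≤ 1 / s`. -/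
theorem exp_div_threshold_pow_le (hs : 12 ≤ √(Real.log n)) (hn : 0 < n) {K : ℝ}
    (hK : K ≤ √(Real.log n)) :
    Real.exp (4 * K) / threshold 4 9 n ^ cutoff 4 9 n ≤ n * (Real.exp 4 / √(Real.log n)) := by
  have hL0 : 0 ≤ Real.log n := Real.log_natCast_nonneg n
  set s := √(Real.log n) with hsd
  have hL : Real.log n = s ^ 2 := (Real.sq_sqrt hL0).symm
  have h1 : (cutoff 4 9 n : ℝ) ≤ √(s ^ 2 - 9 * s) / 2 + 1 := by
    have := cutoff_le (n := n) (by rw [← hsd, hL]; nlinarith)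
    rwa [← hsd, hL] at this
  have h2 : √(s ^ 2 - 9 * s) ≤ s := (Real.sqrt_le_sqrt (by linarith)).trans
    (Real.sqrt_sq (by linarith)).le
  have h3 : √(s ^ 2 - 9 * s) ^ 2 = s ^ 2 - 9 * s := Real.sq_sqrt (by nlinarith)
  have h4 : (4 : ℝ) * (cutoff 4 9 n : ℝ) ^ 2 ≤ s ^ 2 - 5 * s + 4 := by
    have : (cutoff 4 9 n : ℝ) ^ 2 ≤ (√(s ^ 2 - 9 * s) / 2 + 1) ^ 2 := by gcongr
    nlinarith
  rw [threshold, ← Real.exp_nat_mul, ← Real.exp_sub]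
  calc _ ≤ Real.exp (s ^ 2 + (4 + -s)) := Real.exp_le_exp.2 (by nlinarith)
    _ = n * (Real.exp 4 * Real.exp (-s)) := by
        rw [Real.exp_add, Real.exp_add, ← hL, Real.exp_log (by exact_mod_cast hn)]
    _ ≤ _ := by
        rw [div_eq_mul_one_div]
        gcongr
        exact exp_neg_le_inv (by linarith)

/-- Here `√δ = e^(-2k)`, and `3 e^(-2) ≤ 1/2`; the condition `γ > 2 log 3` is what makes such a
ratio less than one. -/
theorem three_pow_mul_sqrt_threshold_le :
    3 ^ cutoff 4 9 n * √(threshold 4 9 n) ≤ 1 / cutoff 4 9 n := by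
  set k := cutoff 4 9 n with hk
  have hk0 : 0 < k := cutoff_pos 4 9 n
  have h1 : √(threshold 4 9 n) = Real.exp (-2) ^ k := by
    rw [threshold, ← Real.exp_nat_mul, ← hk, Real.sqrt_eq_iff_mul_self_eq (Real.exp_pos _).le
      (Real.exp_pos _).le, ← Real.exp_add]
    congr 1; ring
  have h2 : 3 * Real.exp (-2) ≤ 1 / 2 := by
    rw [Real.exp_neg, ← div_eq_mul_inv, div_le_div_iff₀ (Real.exp_pos _) two_pos]
    have := Real.exp_one_gt_d9
    have h : Real.exp 2 = Real.exp 1 * Real.exp 1 := by rw [← Real.exp_add]; norm_num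
    nlinarith
  rw [h1, ← mul_pow]
  refine (pow_le_pow_left₀ (by positivity) h2 k).trans ?_
  rw [div_pow, one_pow]
  refine one_div_le_one_div_of_le (by exact_mod_cast hk0) ?_
  exact_mod_cast Nat.lt_two_pow_self.le

theorem threshold_sq_ge (hs : 12 ≤ √(Real.log n)) :
    Real.exp (-8) * Real.exp (-(4 * √(Real.log n))) ≤ threshold 4 9 n ^ 2 := by
  have hL0 : 0 ≤ Real.log n := Real.log_natCast_nonneg n
  set s := √(Real.log n) with hsd
  have hL : Real.log n = s ^ 2 := (Real.sq_sqrt hL0).symm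
  have h1 : (cutoff 4 9 n : ℝ) ≤ √(s ^ 2 - 9 * s) / 2 + 1 := by
    have := cutoff_le (n := n) (by rw [← hsd, hL]; nlinarith)
    rwa [← hsd, hL] at this
  have h2 : √(s ^ 2 - 9 * s) ≤ s := (Real.sqrt_le_sqrt (by linarith)).trans
    (Real.sqrt_sq (by linarith)).le
  rw [threshold, ← Real.exp_nat_mul, ← Real.exp_add, Real.exp_le_exp]
  push_cast
  linarith

/-- The rate constant of the exponential bound for the selection step. -/
def selectionRate (σ : ℝ≥0) : ℝ := Real.exp (-8) / (6144 * (1 + σ) ^ 2)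

theorem selectionRate_pos (σ : ℝ≥0) : 0 < selectionRate σ := by unfold selectionRate; positivity

/-- In the lower bound on `s`, the term `8 / ε` makes the loss `e^(-4s)` at most a factor `n^(ε/2)`,
and `4 / (selectionRate σ * ε)` lets the remaining `n^(ε/2)` absorb the rate constant, so that `d`
costs only half of the exponent. -/
theorem selection_failure_le {d : ℕ} (hn : 2 ≤ n) (hd : 1 ≤ d) (σ : ℝ≥0) {ε : ℝ} (h0 : 0 < ε)
    (h1 : ε < 1) (hs : 12 + 8 / ε + 4 / (selectionRate σ * ε) ≤ √(Real.log n))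
    (hdn : Real.log d ≤ (n : ℝ) ^ (1 - ε)) :
    8 * d * Real.exp (-((n / 2 : ℕ) * threshold 4 9 n ^ 2 / (2048 * (1 + σ) ^ 2))) ≤
      32 / selectionRate σ / √(Real.log n) := by
  set κ := selectionRate σ with hκ
  have hκ0 : 0 < κ := selectionRate_pos σ
  have hL0 : 0 ≤ Real.log n := Real.log_natCast_nonneg n
  have hs12 : 12 ≤ √(Real.log n) := by
    have : 0 < 8 / ε := by positivity
    have : 0 < 4 / (κ * ε) := by positivity
    linarith
  have hth := threshold_sq_ge hs12
  set s := √(Real.log n) with hsd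
  have hL : Real.log n = s ^ 2 := (Real.sq_sqrt hL0).symm
  have hs8 : 8 ≤ s * ε := by
    rw [← div_le_iff₀ h0]
    have : 0 < 4 / (κ * ε) := by positivity
    linarith
  have hs4 : 4 / κ ≤ s * ε := by
    rw [← div_le_iff₀ h0, div_div]
    have : 0 < 8 / ε := by positivity
    linarith
  have hn0 : (0 : ℝ) < n := by exact_mod_cast (by omega : 0 < n)
  have hnexp : (n : ℝ) = Real.exp (s ^ 2) := by rw [← hL, Real.exp_log hn0]
  -- This is `n^(1 - ε/2)`, halfway in the exponent between the bound on `log d` and `n`.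
  set M := Real.exp ((1 - ε / 2) * s ^ 2) with hM
  have hM0 : 0 < M := Real.exp_pos _
  have hMs : s / 2 ≤ M := by
    refine le_trans ?_ (Real.add_one_le_exp _)
    nlinarith
  have hexpo : κ * M ≤ (n / 2 : ℕ) * threshold 4 9 n ^ 2 / (2048 * (1 + σ) ^ 2) := by
    have a1 : (n : ℝ) / 3 ≤ (n / 2 : ℕ) := by
      rw [div_le_iff₀ (by norm_num)]
      exact_mod_cast (by omega : n ≤ n / 2 * 3)
    have a2 : M ≤ n * Real.exp (-(4 * s)) := by
      rw [hnexp, ← Real.exp_add, hM, Real.exp_le_exp]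
      nlinarith
    calc κ * M ≤ κ * (n * Real.exp (-(4 * s))) := by gcongr
      _ = (n / 3 : ℝ) * (Real.exp (-8) * Real.exp (-(4 * s))) / (2048 * (1 + σ) ^ 2) := by
          rw [hκ, selectionRate]
          field_simp
          ring
      _ ≤ _ := by gcongr
  have hdle : (d : ℝ) ≤ Real.exp (κ / 2 * M) := by
    have hd0 : (0 : ℝ) < d := by exact_mod_cast hd
    rw [← Real.log_le_iff_le_exp hd0]
    refine hdn.trans ?_
    rw [Real.rpow_def_of_pos hn0, hL]
    have b1 : M = Real.exp (s ^ 2 * (1 - ε)) * Real.exp (ε / 2 * s ^ 2) := by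
      rw [hM, ← Real.exp_add]; congr 1; ring
    have b2 : 2 / κ ≤ Real.exp (ε / 2 * s ^ 2) := by
      refine le_trans ?_ (Real.add_one_le_exp _)
      have : 4 / κ = 2 * (2 / κ) := by ring
      nlinarith
    have b3 : 1 ≤ κ / 2 * Real.exp (ε / 2 * s ^ 2) := by
      rw [div_le_iff₀ hκ0] at b2
      linarith
    rw [b1]
    nlinarith [Real.exp_pos (s ^ 2 * (1 - ε))]
  calc _ ≤ 8 * Real.exp (κ / 2 * M) * Real.exp (-(κ * M)) := by gcongr
    _ = 8 * Real.exp (-(κ / 2 * M)) := by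
        rw [mul_assoc, ← Real.exp_add]; congr 2; ring
    _ ≤ 8 * (1 / (κ / 2 * M)) := by gcongr; exact exp_neg_le_inv (by positivity)
    _ ≤ 8 * (1 / (κ / 2 * (s / 2))) := by gcongr
    _ = _ := by field_simp; norm_num

end Asymptotics

/-- The upper bound on the worst-case risk of the Fourier thresholding estimator. -/
theorem exists_worstRisk_fourierEstimator_le {ε : ℝ} (h0 : 0 < ε) (h1 : ε < 1) (σ : ℝ≥0) :
    ∃ C : ℝ, 0 < C ∧ ∀ n d : ℕ, 2 ≤ n → 1 ≤ d → Real.log d ≤ (n : ℝ) ^ (1 - ε) →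
      ∀ ν : Fin n → Measure ℝ, IsNoise σ ν → ∀ K : ℝ, 1 ≤ K →
        worstRisk ν K (fourierEstimator (n := n) (d := d) 4 9) ≤
          ENNReal.ofReal (C * (K / √(Real.log n))) := by
  set s₀ := 12 + 8 / ε + 4 / (selectionRate σ * ε) with hs₀
  have hκ0 := selectionRate_pos σ
  have hv : 0 ≤ momentBound σ := by unfold momentBound; positivity
  have hs₀12 : 12 ≤ s₀ := by
    have : 0 < 8 / ε := by positivity
    have : 0 < 4 / (selectionRate σ * ε) := by positivity
    linarith
  set C₁ := 32 / selectionRate σ + 2 * momentBound σ * Real.exp 4 + 2 with hC₁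
  have hC₁0 : 0 < C₁ := by positivity
  refine ⟨s₀ + C₁, by linarith, fun n d hn hd hdn ν hν K hK => iSup₂_le fun f hf => ?_⟩
  have hL0 : 0 < Real.log n := Real.log_pos (by exact_mod_cast hn)
  set s := √(Real.log n) with hs
  have hs0 : 0 < s := Real.sqrt_pos.2 hL0
  -- Otherwise the claimed bound is at least `1`: through `s₀` and `1 ≤ K` if `s < s₀`, and through
  -- `C₁ ≥ 1` if `s < K`.
  by_cases hcase : s₀ ≤ s ∧ K ≤ s
  · obtain ⟨hss, hKs⟩ := hcase
    have hs12 : 12 ≤ s := hs₀12.trans hss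
    refine (risk_fourierEstimator_le (by omega) hν (by norm_num) hf).trans
      (ENNReal.ofReal_le_ofReal ?_)
    have hn0 : (0 : ℝ) < n := by exact_mod_cast (by omega : 0 < n)
    have t1 := selection_failure_le hn hd σ h0 h1 hss hdn
    have t2 : Real.exp (4 * K) / threshold 4 9 n ^ cutoff 4 9 n * (2 * momentBound σ / n) ≤
        2 * momentBound σ * Real.exp 4 / s := by
      calc _ ≤ n * (Real.exp 4 / s) * (2 * momentBound σ / n) := by
            gcongr
            exact exp_div_threshold_pow_le hs12 (by omega) hKs
        _ = _ := by field_simp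
    have hk := cutoff_ge hs12
    rw [← hs] at hk t1
    have hk0 : (0 : ℝ) < cutoff 4 9 n := by linarith
    have t3 : K / (4 * cutoff 4 9 n) ≤ K / s := by
      gcongr
      linarith
    have t4 : 3 ^ cutoff 4 9 n * √(threshold 4 9 n) * K / 4 ≤ K / s := by
      refine le_trans ?_ t3
      calc _ ≤ 1 / cutoff 4 9 n * K / 4 := by
            gcongr
            exact three_pow_mul_sqrt_threshold_le
        _ = _ := by field_simp
    have t5 : 1 / s ≤ K / s := by gcongr
    have e : (s₀ + C₁) * (K / s) = s₀ * (K / s) + 32 / selectionRate σ * (K / s)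
        + 2 * momentBound σ * Real.exp 4 * (K / s) + 2 * (K / s) := by rw [hC₁]; ring
    have e1 : 32 / selectionRate σ / s ≤ 32 / selectionRate σ * (K / s) := by
      rw [div_eq_mul_one_div _ s]; gcongr
    have e2 : 2 * momentBound σ * Real.exp 4 / s ≤ 2 * momentBound σ * Real.exp 4 * (K / s) := by
      rw [div_eq_mul_one_div _ s]; gcongr
    have e3 : 0 ≤ s₀ * (K / s) := by positivity
    linarith
  · refine (risk_fourierEstimator_le_one hν 4 9 hf.1).trans ?_
    rw [ENNReal.one_le_ofReal, ← mul_div_assoc, le_div_iff₀ hs0, one_mul]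
    have hC₁1 : 1 ≤ C₁ := by
      have : 0 < 32 / selectionRate σ := by positivity
      have : 0 ≤ 2 * momentBound σ * Real.exp 4 := by positivity
      linarith
    rcases not_and_or.1 hcase with h | h
    · nlinarith
    · nlinarith

/-! ### Subcubes, layers and the size of the middle layer. -/

section Restriction

variable {m d : ℕ}

/-- The first `m` coordinates of a point of the hypercube. -/
def restrict (h : m ≤ d) (x : Cube d) : Cube m := fun i => x (Fin.castLE h i)

theorem mean_comp_restrict (h : m ≤ d) (F : Cube m → ℝ) :
    mean (fun x : Cube d => F (restrict h x)) = mean F := by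
  obtain ⟨r, rfl⟩ := Nat.exists_eq_add_of_le h
  have h1 : ∑ x : Cube (m + r), F (restrict h x) = 2 ^ r * ∑ y, F y := by
    rw [← Equiv.sum_comp (Fin.appendEquiv m r), Fintype.sum_prod_type]
    have : ∀ (y : Cube m) (z : Cube r), restrict h (Fin.append y z) = y := by
      intro y z
      funext i
      exact Fin.append_left y z i
    simp only [Fin.appendEquiv, Equiv.coe_fn_mk, this, Finset.sum_const, Finset.card_univ,
      nsmul_eq_mul, ← Finset.mul_sum]
    simp
  rw [mean, mean, h1, pow_add]
  field_simp

theorem mean_indicator (A : Finset (Cube m)) :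
    mean (fun y => if y ∈ A then (1 : ℝ) else 0) = A.card / 2 ^ m := by
  simp [mean]

/-- The Hamming weight. -/
def weight (y : Cube m) : ℕ := (Finset.univ.filter fun i => y i = true).card

theorem support_subset {y z : Cube m} (h : y ≤ z) :
    (Finset.univ.filter fun i => y i = true) ⊆ Finset.univ.filter fun i => z i = true := by
  intro i hi
  simp only [Finset.mem_filter, Finset.mem_univ, true_and] at hi ⊢
  have := h i
  rw [hi] at this
  exact top_le_iff.1 this

theorem weight_mono : Monotone (weight (m := m)) := fun _ _ h =>
  Finset.card_le_card (support_subset h)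

theorem eq_of_le_of_weight_eq {y z : Cube m} (h : y ≤ z) (hw : weight y = weight z) : y = z := by
  have := Finset.eq_of_subset_of_card_le (support_subset h) hw.ge
  ext i
  simpa using Finset.ext_iff.1 this i

theorem card_layer (k : ℕ) :
    (Finset.univ.filter fun y : Cube m => weight y = k).card = m.choose k := by
  rw [← Fintype.card_fin m, ← Finset.card_univ, ← Finset.card_powersetCard, Finset.card_univ,
    Fintype.card_fin]
  refine Finset.card_nbij' (fun y => Finset.univ.filter fun i => y i = true)
    (fun S i => decide (i ∈ S)) ?_ ?_ ?_ ?_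
  · intro y hy
    exact Finset.mem_powersetCard.2 ⟨Finset.subset_univ _, (Finset.mem_filter.1 hy).2⟩
  · intro S hS
    refine Finset.mem_filter.2 ⟨Finset.mem_univ _, ?_⟩
    rw [← (Finset.mem_powersetCard.1 hS).2]
    simp [weight]
  · intro y _
    simp
  · intro S _
    simp

/-- The squared form carries the induction, since its step reduces to `4k(k + 1) ≤ (2k + 1)²`. -/
theorem four_pow_le_sqrt_mul_centralBinom (k : ℕ) (hk : 1 ≤ k) :
    (4 : ℝ) ^ k ≤ 2 * √k * k.centralBinom := by
  have key : (16 : ℝ) ^ k ≤ 4 * k * (k.centralBinom : ℝ) ^ 2 := by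
    induction k, hk using Nat.le_induction with
    | base => norm_num [Nat.centralBinom]
    | succ k hk ih =>
      have h : ((k : ℝ) + 1) * (k + 1).centralBinom = 2 * (2 * k + 1) * k.centralBinom := by
        exact_mod_cast Nat.succ_mul_centralBinom_succ k
      have hk0 : (0 : ℝ) < (k : ℝ) + 1 := by positivity
      refine le_of_mul_le_mul_left ?_ hk0
      push_cast
      calc ((k : ℝ) + 1) * 16 ^ (k + 1) = 16 * (k + 1) * 16 ^ k := by ring
        _ ≤ 16 * (k + 1) * (4 * k * (k.centralBinom : ℝ) ^ 2) := by gcongr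
        _ = 16 * (4 * k * (k + 1)) * (k.centralBinom : ℝ) ^ 2 := by ring
        _ ≤ 16 * (2 * k + 1) ^ 2 * (k.centralBinom : ℝ) ^ 2 := by gcongr; nlinarith
        _ = 4 * (2 * (2 * k + 1) * k.centralBinom) ^ 2 := by ring
        _ = (k + 1) * (4 * (k + 1) * ((k + 1).centralBinom : ℝ) ^ 2) := by rw [← h]; ring
  refine abs_le_of_sq_le_sq' ?_ (by positivity) |>.2
  rw [mul_pow, mul_pow, Real.sq_sqrt (Nat.cast_nonneg k), ← pow_mul, mul_comm k, pow_mul]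
  calc _ = (16 : ℝ) ^ k := by norm_num
    _ ≤ _ := by linarith

end Restriction

/-! ### Total influence of monotone functions of few coordinates. -/

section Influence

variable {d : ℕ} {f : Cube d → ℝ}

theorem influence_eq_fourierCoeff (hf : Monotone f) (i : Fin d) :
    influence i f = 2 * fourierCoeff f {i} := by
  rw [influence_eq_faceMean_sub hf]
  have h1 := mean_mul_coordIndicator f i true
  have h2 := mean_mul_coordIndicator f i false
  have h3 : fourierCoeff f {i} = mean (fun x => f x * coordIndicator i true x)
      - mean (fun x => f x * coordIndicator i false x) := by
    rw [← mean_sub, fourierCoeff]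
    congr 1
    ext x
    cases h : x i <;> simp [character, coordIndicator, h]
  rw [h3, h1, h2]
  ring

/-- A monotone function with values in `[0, a]` that depends only on the coordinates in `M` has
total influence at most `2 a √|M|`. -/
theorem totalInfluence_le_of_dependsOn (hf : Monotone f) {a : ℝ} (ha : 0 ≤ a)
    (hfa : ∀ x, f x ∈ Set.Icc 0 a) (M : Finset (Fin d))
    (hM : ∀ i ∉ M, ∀ x, f (flip i x) = f x) :
    totalInfluence f ≤ 2 * a * √M.card := by
  have h0 : totalInfluence f = ∑ i ∈ M, influence i f := by
    refine (Finset.sum_subset (Finset.subset_univ M) fun i _ hi => ?_).symm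
    simp [influence_eq, hM i hi, mean_const]
  -- For monotone functions influences are twice the degree-one coefficients, so Parseval bounds
  -- their squares and Cauchy–Schwarz over `M` gives the factor `√|M|`.
  have h1 : ∑ i ∈ M, fourierCoeff f {i} ^ 2 ≤ a ^ 2 := by
    calc ∑ i ∈ M, fourierCoeff f {i} ^ 2
        = ∑ S ∈ M.map ⟨fun i => ({i} : Finset (Fin d)), Finset.singleton_injective⟩,
            fourierCoeff f S ^ 2 := by rw [Finset.sum_map]; rfl
      _ ≤ ∑ S, fourierCoeff f S ^ 2 :=
          Finset.sum_le_sum_of_subset_of_nonneg (Finset.subset_univ _) fun S _ _ => sq_nonneg _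
      _ = normSq f := (parseval f).symm
      _ ≤ a ^ 2 := by
          refine le_trans (mean_mono fun x => ?_) (mean_const (d := d) _).le
          exact pow_le_pow_left₀ (hfa x).1 (hfa x).2 2
  have h2 : ∑ i ∈ M, fourierCoeff f {i} ≤ √M.card * a := by
    refine abs_le_of_sq_le_sq' ?_ (by positivity) |>.2
    rw [mul_pow, Real.sq_sqrt (Nat.cast_nonneg _)]
    refine (sq_sum_le_card_mul_sum_sq).trans ?_
    gcongr
  rw [h0, Finset.sum_congr rfl fun i _ => influence_eq_fourierCoeff hf i, ← Finset.mul_sum]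
  linarith

end Influence

/-! ### Minimax lower bound from random values on a layer. -/

section LowerBound

variable {n m d k : ℕ}

/-- The monotone function that is `a` above the `k`-th layer of the first `m` coordinates, `0`
below it, and `a τ` on it. -/
def layerFun (h : m ≤ d) (k : ℕ) (a : ℝ) (τ : Cube m → Bool) (x : Cube d) : ℝ :=
  if k < weight (restrict h x) ∨ (weight (restrict h x) = k ∧ τ (restrict h x) = true) then a
  else 0

theorem layerFun_mem {h : m ≤ d} {a : ℝ} (ha : 0 ≤ a) (τ : Cube m → Bool) (x : Cube d) :
    layerFun h k a τ x ∈ Set.Icc 0 a := by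
  unfold layerFun; split_ifs <;> simp [ha]

/-- A layer is an antichain, so the values on it are unconstrained by monotonicity. -/
theorem monotone_layerFun {h : m ≤ d} {a : ℝ} (ha : 0 ≤ a) (τ : Cube m → Bool) :
    Monotone (layerFun h k a τ) := by
  intro x y hxy
  by_cases hx : k < weight (restrict h x) ∨
      (weight (restrict h x) = k ∧ τ (restrict h x) = true)
  · have hr : restrict h x ≤ restrict h y := fun i => hxy _
    have hw := weight_mono hr
    have hy : k < weight (restrict h y) ∨
        (weight (restrict h y) = k ∧ τ (restrict h y) = true) := by
      rcases hx with hx | ⟨hx, hτ⟩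
      · exact Or.inl (hx.trans_le hw)
      · rw [hx] at hw
        rcases hw.lt_or_eq with hlt | heq
        · exact Or.inl hlt
        · rw [← eq_of_le_of_weight_eq hr (hx.trans heq)]
          exact Or.inr ⟨hx, hτ⟩
    rw [layerFun, layerFun, if_pos hx, if_pos hy]
  · rw [layerFun, if_neg hx]
    exact (layerFun_mem ha τ y).1

theorem layerFun_mem_monotoneClass {h : m ≤ d} {a K : ℝ} (ha : 0 ≤ a) (ha1 : a ≤ 1)
    (hK : 2 * a * √m ≤ K) (τ : Cube m → Bool) : layerFun h k a τ ∈ monotoneClass d K := by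
  refine ⟨fun x => ⟨(layerFun_mem ha τ x).1, (layerFun_mem ha τ x).2.trans ha1⟩,
    monotone_layerFun ha τ, le_trans ?_ hK⟩
  have hcard : (Finset.univ.filter fun i : Fin d => (i : ℕ) < m).card = m := by
    rw [Fin.card_filter_val_lt, min_eq_right h]
  have := totalInfluence_le_of_dependsOn (monotone_layerFun (h := h) (k := k) ha τ) ha
    (layerFun_mem ha τ) (Finset.univ.filter fun i : Fin d => (i : ℕ) < m) (fun i hi x => by
      have hr : restrict h (flip i x) = restrict h x := by
        funext j
        refine Function.update_of_ne (fun hij => hi ?_) _ _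
        rw [← hij]
        simp
      simp only [layerFun, hr])
  rwa [hcard] at this

theorem observe_layerFun_update {h : m ≤ d} {a : ℝ} (τ : Cube m → Bool) (y : Cube m) (b : Bool)
    {p : Fin n → Cube d × ℝ} (hp : ∀ j, restrict h (p j).1 ≠ y) :
    observe (layerFun h k a (Function.update τ y b)) p = observe (layerFun h k a τ) p := by
  funext j
  simp only [observe, layerFun, Function.update_of_ne (hp j)]

/-- At a point of the layer that the design has missed, the average squared error over the random
signs is at least `a² / 4`. -/
theorem sum_sq_error_ge {h : m ≤ d} {a : ℝ} (g : Sample n d → Cube d → ℝ)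
    {p : Fin n → Cube d × ℝ} {x : Cube d} (hx : weight (restrict h x) = k)
    (hp : ∀ j, restrict h (p j).1 ≠ restrict h x) :
    Fintype.card (Cube m → Bool) * (a ^ 2 / 4) ≤
      ∑ τ : Cube m → Bool, (g (observe (layerFun h k a τ) p) x - layerFun h k a τ x) ^ 2 := by
  set F : (Cube m → Bool) → ℝ := fun τ =>
    (g (observe (layerFun h k a τ) p) x - layerFun h k a τ x) ^ 2 with hF
  -- Flipping the sign at the missed point leaves the sample, hence the estimate `u`, unchanged; the
  -- paired errors satisfy `u² + (u - a)² ≥ a² / 2`.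
  set e : (Cube m → Bool) → (Cube m → Bool) := fun τ =>
    Function.update τ (restrict h x) (!τ (restrict h x)) with he
  have hee : ∀ τ, e (e τ) = τ := fun τ => by simp [he]
  have hsum : ∑ τ, F (e τ) = ∑ τ, F τ := Equiv.sum_comp ⟨e, e, hee, hee⟩ F
  have hpair : ∀ τ, a ^ 2 / 2 ≤ F τ + F (e τ) := by
    intro τ
    have h1 : ∀ τ', layerFun h k a τ' x = if τ' (restrict h x) = true then a else 0 := by
      intro τ'
      simp [layerFun, hx]
    simp only [hF, he]
    rw [observe_layerFun_update τ _ _ hp, h1, h1, Function.update_self]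
    set u := g (observe (layerFun h k a τ) p) x
    cases τ (restrict h x) <;> simp <;> nlinarith [sq_nonneg (2 * u - a)]
  have h2 : ∑ _τ : Cube m → Bool, a ^ 2 / 2 ≤ ∑ τ, (F τ + F (e τ)) :=
    Finset.sum_le_sum fun τ _ => hpair τ
  rw [Finset.sum_add_distrib, hsum, Finset.sum_const, Finset.card_univ, nsmul_eq_mul] at h2
  linarith

theorem sum_normSq_error_ge {h : m ≤ d} {a : ℝ} (g : Sample n d → Cube d → ℝ)
    (p : Fin n → Cube d × ℝ) :
    Fintype.card (Cube m → Bool) * (a ^ 2 / 4 * ((m.choose k - n) / 2 ^ m)) ≤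
      ∑ τ : Cube m → Bool,
        normSq fun x => g (observe (layerFun h k a τ) p) x - layerFun h k a τ x := by
  set A : Finset (Cube m) := (Finset.univ.filter fun y : Cube m => weight y = k) \
    Finset.univ.image fun j => restrict h (p j).1 with hA
  have hcard : (m.choose k : ℝ) - n ≤ A.card := by
    have h1 := Finset.le_card_sdiff (Finset.univ.image fun j => restrict h (p j).1)
      (Finset.univ.filter fun y : Cube m => weight y = k)
    rw [card_layer, ← hA] at h1
    have h2 : (Finset.univ.image fun j => restrict h (p j).1).card ≤ n :=
      Finset.card_image_le.trans (by simp)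
    have h3 : m.choose k ≤ A.card + n := by omega
    have h4 : (m.choose k : ℝ) ≤ A.card + n := by exact_mod_cast h3
    linarith
  have hpt : ∀ x : Cube d, Fintype.card (Cube m → Bool) * (a ^ 2 / 4) *
      (if restrict h x ∈ A then (1 : ℝ) else 0) ≤ ∑ τ : Cube m → Bool,
        (g (observe (layerFun h k a τ) p) x - layerFun h k a τ x) ^ 2 := by
    intro x
    split_ifs with hx
    · rw [mul_one]
      simp only [hA, Finset.mem_sdiff, Finset.mem_filter, Finset.mem_univ, true_and,
        Finset.mem_image, not_exists] at hx
      exact sum_sq_error_ge g hx.1 hx.2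
    · rw [mul_zero]
      exact Finset.sum_nonneg fun τ _ => sq_nonneg _
  have hm := mean_mono hpt
  rw [mean_const_mul, mean_comp_restrict h (fun y => if y ∈ A then (1 : ℝ) else 0),
    mean_indicator, mean_sum] at hm
  refine le_trans ?_ hm
  rw [mul_assoc]
  gcongr

/-- The worst risk dominates the average over all `τ`, and the averaged loss is bounded below for
every realization of design and noise. -/
theorem minimaxRisk_ge {ν : Fin n → Measure ℝ} [∀ j, IsProbabilityMeasure (ν j)] (h : m ≤ d)
    (k : ℕ) {a K : ℝ} (ha : 0 ≤ a) (ha1 : a ≤ 1) (hK : 2 * a * √m ≤ K) :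
    ENNReal.ofReal (a ^ 2 / 4 * ((m.choose k - n) / 2 ^ m)) ≤
      minimaxRisk (n := n) (d := d) ν K := by
  refine le_iInf₂ fun g hg => ?_
  set r := a ^ 2 / 4 * (((m.choose k : ℝ) - n) / 2 ^ m) with hr
  set N := Fintype.card (Cube m → Bool) with hN
  have hN0 : (N : ℝ≥0∞) ≠ 0 := by
    rw [hN]; exact_mod_cast Fintype.card_ne_zero
  have h1 : ∑ τ : Cube m → Bool, risk ν g (layerFun h k a τ) ≤ N * worstRisk ν K g := by
    rw [hN, ← nsmul_eq_mul, ← Finset.card_univ, ← Finset.sum_const]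
    exact Finset.sum_le_sum fun τ _ =>
      le_iSup₂ (f := fun f (_ : f ∈ monotoneClass d K) => risk ν g f) (layerFun h k a τ)
        (layerFun_mem_monotoneClass ha ha1 hK τ)
  have h2 : N * ENNReal.ofReal r ≤ ∑ τ : Cube m → Bool, risk ν g (layerFun h k a τ) := by
    simp only [risk_eq ν hg]
    have hm : ∀ τ, Measurable fun p => ENNReal.ofReal
        (normSq fun x => g (observe (layerFun h k a τ) p) x - layerFun h k a τ x) := fun τ =>
      (measurable_loss hg (layerFun h k a τ)).comp (measurable_observe (layerFun h k a τ))
    rw [← lintegral_finsetSum _ fun τ _ => hm τ]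
    calc N * ENNReal.ofReal r = ∫⁻ _, N * ENNReal.ofReal r ∂(designNoiseLaw d ν) := by simp
      _ ≤ _ := lintegral_mono fun p => by
        rw [← ENNReal.ofReal_sum_of_nonneg fun τ _ => normSq_nonneg _, ← ENNReal.ofReal_natCast,
          ← ENNReal.ofReal_mul (Nat.cast_nonneg _)]
        exact ENNReal.ofReal_le_ofReal (sum_normSq_error_ge g p)
  exact (ENNReal.mul_le_mul_iff_right hN0 (ENNReal.natCast_ne_top N)).1 (h2.trans h1)

end LowerBound

/-- The minimax lower bound. -/
theorem minimaxRisk_ge_rate {n d : ℕ} (hn : 2 ≤ n) (hd : 2000 * Real.log n ≤ d)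
    {ν : Fin n → Measure ℝ} [∀ j, IsProbabilityMeasure (ν j)] {K : ℝ} (hK0 : 0 < K)
    (hK : K ≤ 1 / 2000 * √(Real.log n)) :
    ENNReal.ofReal (1 / 2000 * (K ^ 2 / Real.log n ^ (3 / 2 : ℝ))) ≤
      minimaxRisk (n := n) (d := d) ν K := by
  set L := Real.log n with hL
  have hn0 : (0 : ℝ) < n := by exact_mod_cast (by omega : 0 < n)
  have hn2 : (2 : ℝ) ≤ n := by exact_mod_cast hn
  have hL2 : 1 / 2 ≤ L := by
    have := Real.log_le_log two_pos hn2
    linarith [Real.log_two_gt_d9]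
  set k := ⌈4 * L⌉₊ with hk
  have hk1 : 4 * L ≤ k := Nat.le_ceil _
  have hk2 : (k : ℝ) ≤ 6 * L := by
    have := (Nat.ceil_lt_add_one (a := 4 * L) (by linarith)).le
    linarith
  have hk0 : (1 : ℝ) ≤ k := by linarith
  have hkN : 1 ≤ k := by exact_mod_cast hk0
  have hm : 2 * k ≤ d := by
    have : (2 * k : ℝ) ≤ d := by linarith
    exact_mod_cast this
  have hsk : 0 < √(k : ℝ) := Real.sqrt_pos.2 (by linarith)
  have hsk2 : √(k : ℝ) ^ 2 = k := Real.sq_sqrt (by linarith)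
  have h2k : 2 * (n : ℝ) ≤ 2 ^ k := by
    have h1 : (2 : ℝ) ^ k = Real.exp (k * Real.log 2) := by
      rw [Real.exp_nat_mul, Real.exp_log two_pos]
    have h2 : Real.exp (2 * L) = (n : ℝ) ^ 2 := by
      rw [hL, mul_comm, Real.exp_mul, Real.exp_log hn0]
      norm_num
    have h3 : Real.exp (2 * L) ≤ 2 ^ k := by
      rw [h1, Real.exp_le_exp]
      nlinarith [Real.log_two_gt_d9]
    rw [h2] at h3
    nlinarith
  have hkk : 2 * (k : ℝ) ≤ 2 ^ k := by
    obtain ⟨j, hj⟩ := Nat.exists_eq_add_of_le hkN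
    rw [hj, pow_add]
    have : (1 + j : ℕ) ≤ 2 ^ j := by rw [add_comm]; exact Nat.lt_two_pow_self
    have : ((1 + j : ℕ) : ℝ) ≤ 2 ^ j := by exact_mod_cast this
    linarith
  have h4k : 4 * n * √(k : ℝ) ≤ 4 ^ k := by
    have h1 : √(k : ℝ) ≤ k := by nlinarith
    calc 4 * n * √(k : ℝ) ≤ 4 * n * k := by gcongr
      _ = (2 * n) * (2 * k) := by ring
      _ ≤ 2 ^ k * 2 ^ k := by gcongr
      _ = 4 ^ k := by rw [← mul_pow]; norm_num
  have hmass : 1 / (4 * √(k : ℝ)) ≤ (((2 * k).choose k : ℝ) - n) / 2 ^ (2 * k) := by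
    have h1 := four_pow_le_sqrt_mul_centralBinom k hkN
    rw [Nat.centralBinom] at h1
    rw [pow_mul, div_le_div_iff₀ (by positivity) (by positivity), one_mul]
    norm_num
    nlinarith
  -- The largest height for which the bound `2a√(2k)` on the influence is at most `K`.
  set a := K / (2 * √(2 * k : ℝ)) with ha
  have hs2k : 0 < √(2 * k : ℝ) := Real.sqrt_pos.2 (by linarith)
  have ha0 : 0 ≤ a := by positivity
  have ha1 : a ≤ 1 := by
    rw [ha, div_le_one (by positivity)]
    have : √L ≤ √(2 * k : ℝ) := Real.sqrt_le_sqrt (by linarith)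
    linarith [Real.sqrt_nonneg L]
  have haK : 2 * a * √((2 * k : ℕ) : ℝ) ≤ K := by
    push_cast
    rw [ha]
    exact le_of_eq (by field_simp)
  refine le_trans (ENNReal.ofReal_le_ofReal ?_) (minimaxRisk_ge hm k ha0 ha1 haK)
  refine le_trans ?_ (mul_le_mul_of_nonneg_left hmass (by positivity))
  have ha2 : a ^ 2 = K ^ 2 / (8 * k) := by
    rw [ha, div_pow, mul_pow, Real.sq_sqrt (by linarith)]
    ring
  have hL32 : L ^ (3 / 2 : ℝ) = L * √L := by
    rw [show (3 / 2 : ℝ) = 1 + 1 / 2 by norm_num, Real.rpow_add (by linarith), Real.rpow_one,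
      ← Real.sqrt_eq_rpow]
  have hsL : 0 < √L := Real.sqrt_pos.2 (by linarith)
  have hkL : (k : ℝ) * √k ≤ 15 * (L * √L) := by
    have h1 : √(k : ℝ) ≤ 5 / 2 * √L := by
      refine abs_le_of_sq_le_sq' ?_ (by positivity) |>.2
      rw [hsk2, mul_pow, Real.sq_sqrt (by linarith)]
      linarith
    calc (k : ℝ) * √k ≤ (6 * L) * (5 / 2 * √L) := by gcongr
      _ = _ := by ring
  have hL0 : 0 < L := by linarith
  rw [ha2, hL32]
  calc 1 / 2000 * (K ^ 2 / (L * √L)) = K ^ 2 / (2000 * (L * √L)) := by field_simp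
    -- The loss is `a² / 4` times the missed mass `1 / (4√k)`, with `a² = K² / (8k)`, hence `128`;
    -- and `128 * 15 ≤ 2000`.
    _ ≤ K ^ 2 / (128 * (k * √k)) := by
        refine div_le_div_of_nonneg_left (sq_nonneg K) (by positivity) ?_
        linarith [mul_pos hL0 hsL]
    _ = _ := by field_simp; norm_num

end

end MonotoneCube

theorem theorem1 :
    ∃ γ c₀ : ℝ, 2 * Real.log 3 < γ ∧ 0 < c₀ ∧
      ∀ ε : ℝ, 0 < ε → ε < 1 → ∀ σ : ℝ≥0,
        ∃ c C : ℝ, 0 < c ∧ 0 < C ∧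
          ∀ n d : ℕ, 2 ≤ n → 1 ≤ d →
            -- the upper bound
            (Real.log d ≤ (n : ℝ) ^ (1 - ε) →
              Measurable
                (MonotoneCube.fourierEstimator (n := n) (d := d) γ c₀) ∧
              ∀ ν : Fin n → MeasureTheory.Measure ℝ, MonotoneCube.IsNoise σ ν →
                ∀ K : ℝ, 1 ≤ K → K ≤ d →
                  MonotoneCube.worstRisk ν K
                      (MonotoneCube.fourierEstimator (n := n) (d := d) γ c₀) ≤
                    ENNReal.ofReal (C * (K / √(Real.log n)))) ∧
            -- the lower bound
            (1 / c * Real.log n ≤ d →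
              ∀ ν : Fin n → MeasureTheory.Measure ℝ, MonotoneCube.IsNoise σ ν →
                ∀ K : ℝ, 0 < K → K ≤ c * √(Real.log n) →
                  ENNReal.ofReal (c * (K ^ 2 / Real.log n ^ (3 / 2 : ℝ))) ≤
                    MonotoneCube.minimaxRisk (n := n) (d := d) ν K) := by
  have hlog : Real.log 3 < 2 := by
    rw [Real.log_lt_iff_lt_exp (by norm_num)]
    have h : Real.exp 2 = Real.exp 1 * Real.exp 1 := by rw [← Real.exp_add]; norm_num
    nlinarith [Real.exp_one_gt_d9]
  refine ⟨4, 9, by linarith, by norm_num, fun ε h0 h1 σ => ?_⟩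
  obtain ⟨C, hC0, hC⟩ := MonotoneCube.exists_worstRisk_fourierEstimator_le h0 h1 σ
  refine ⟨1 / 2000, C, by norm_num, hC0, fun n d hn hd => ⟨fun hdn => ?_, fun hdn => ?_⟩⟩
  · exact ⟨MonotoneCube.measurable_fourierEstimator 4 9, fun ν hν K hK _ =>
      hC n d hn hd hdn ν hν K hK⟩
  · intro ν hν K hK0 hK
    have := hν.isProbabilityMeasure
    exact MonotoneCube.minimaxRisk_ge_rate hn (by linarith) hK0 hK
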